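/- \textbf{Setting.} Let $p\ge 1$ be fixed and let $(x_i,y_i)$, $i=1,2,\dots$, be independent and identically distributed with $x_i\in\mathbb R^p$, $y_i\in\mathbb R$. Given $x_i$, the response $y_i$ follows a generalised linear model with canonical link: its conditional density with respect to a $\sigma$-finite base measure is $f_0(y;x_i,\beta_0)=\exp[\{y\theta_i-b(\theta_i)\}/\phi+c(y,\phi)]$ with $\theta_i=x_i^T\beta_0$, where the natural parameter ranges over an open interval $\Theta\subseteq\mathbb R$ (typically $\Theta=\mathbb R$), the dispersion $\phi>0$ is known, and the link $g$ is the inverse of the mean function, $g^{-1}=b'$ on $\Theta$. Write $\dot g(x^T\beta)$ for the derivative of $g$ at the mean $g^{-1}(x^T\beta)$, and let $X$ be the $n\times p$ matrix with rows $x_1^T,\dots,x_n^T$. Put $$S_n(\beta)=\frac1n\sum_{i=1}^n\{y_i-g^{-1}(x_i^T\beta)\}x_i/\phi,\qquad \dot S_n(\beta)=-\frac1n\sum_{i=1}^n \frac{x_ix_i^T}{\phi\,\dot g(x_i^T\beta)},\qquad \hat\Sigma_n(\beta)=\{-\dot S_n(\beta)\}^{-1}.$$ For $n>p$ let $\lambda=\lambda_n=(\log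 p/n)^{1/2}$ and let the lasso estimator $\hat\beta_\lambda$ be a (measurable) maximiser of $$\frac1n\sum_{i=1}^n\{y_ix_i^T\beta-b(x_i^T\beta)\}/\phi-\lambda\|\beta\|_1$$ over the $\beta\in\mathbb R^p$ with $x_i^T\beta\in\Theta$ for $i\le n$. The bias-corrected (one-step Newton) estimator is $\hat\beta^c_\lambda=\hat\beta_\lambda+\hat\Sigma_n(\hat\beta_\lambda)S_n(\hat\beta_\lambda)$. \textbf{Conditions.} (C1) $E[\{y_1-g^{-1}(x_1^T\beta_0)\}x_1/\phi]=0$, and there is $\delta>0$ such that, for all $\beta$ with $\|\beta-\beta_0\|_1<\delta$ and for $x$ outside a null set of the law of $x_1$ (not depending on $\beta$ in the first and last of the following requirements): $x^T\beta\in\Theta$; $|\{\dot g(x^T\beta)\}^{-1}|$ is bounded away from zero and bounded above, uniformly in $x$; and $|\{\dot g(x^T\beta)\}^{-1}-\{\dot g(x^T\beta_0)\}^{-1}|\le|x^T(\beta-\beta_0)|$. (C2) $\max_{i,j}|X_{ij}|=O_p(1)$, and there are constants $0<l,u<\infty$ such that, with probability tending to one, all $p$ singular values of $n^{-1/2}X$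 lie in $[l,u]$. (C3) With $s_0=\#\{j:\beta_{0,j}\ne0\}$: $s_0\log p=o(n^{1/2})$, $\|\hat\beta_\lambda-\beta_0\|_1=O_p(s_0\lambda_n)$ and $n^{-1}\|X(\hat\beta_\lambda-\beta_0)\|_2^2=O_p(s_0\lambda_n^2)$. \textbf{Theorem 1.} Under (C1)–(C3), the matrix $E\{x_1x_1^T/(\phi\,\dot g(x_1^T\beta_0))\}$ is positive definite and is the Fisher information matrix of one observation, $E[\nabla_\beta\log f_0(y_1;x_1,\beta_0)\,\nabla_\beta\log f_0(y_1;x_1,\beta_0)^T]$. Let $\Sigma(\beta_0)$ be its inverse. As $n\to\infty$, $\hat\beta^c_\lambda\to\beta_0$ in probability and $$n^{1/2}(\hat\beta^c_\lambda-\beta_0)\overset{d}{\to}\mathcal N(0,\Sigma(\beta_0)).$$ -/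

import Mathlib

open MeasureTheory ProbabilityTheory Filter Topology

/-- `Z n = O_p (a n)`: for every `ε > 0` there is a constant `C` such that
`P (|Z n| > C * a n) ≤ ε` for all large `n`. -/
def IsBigOP {Ω : Type*} [MeasurableSpace Ω] (P : Measure Ω) (Z : ℕ → Ω → ℝ) (a : ℕ → ℝ) : Prop :=
  ∀ ε : ℝ, 0 < ε → ∃ C : ℝ, ∀ᶠ n in atTop, P {ω | C * a n < |Z n ω|} ≤ ENNReal.ofReal ε

/-- The `ℓ¹` norm of a vector. -/
noncomputable def l1Norm {p : ℕ} (v : EuclideanSpace ℝ (Fin p)) : ℝ := ∑ j, |v j|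

/-- The number `s₀` of non-zero entries of a vector. -/
noncomputable def numNonzero {p : ℕ} (v : EuclideanSpace ℝ (Fin p)) : ℕ :=
  Set.ncard {j : Fin p | v j ≠ 0}

/-- The `n × p` design matrix whose rows are the first `n` covariate vectors. -/
def designMatrix {p : ℕ} (n : ℕ) (xs : ℕ → EuclideanSpace ℝ (Fin p)) :
    Matrix (Fin n) (Fin p) ℝ :=
  Matrix.of fun i j => xs i j

/-- The largest absolute value of an entry of a matrix. -/
noncomputable def maxAbsEntry {m p : ℕ} (A : Matrix (Fin m) (Fin p) ℝ) : ℝ :=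
  ⨆ i : Fin m, ⨆ j : Fin p, |A i j|

/-- The smallest of the `p` singular values of a matrix with `p` columns
(Mathlib numbers them `0, …, p - 1` in decreasing order). -/
noncomputable def minSingularValue {m p : ℕ} (A : Matrix (Fin m) (Fin p) ℝ) : ℝ :=
  (Matrix.toEuclideanLin A).singularValues (p - 1)

/-- The largest singular value of a matrix. -/
noncomputable def maxSingularValue {m p : ℕ} (A : Matrix (Fin m) (Fin p) ℝ) : ℝ :=
  (Matrix.toEuclideanLin A).singularValues 0

/-- The random component and the link of a generalised linear model with canonical link: the
exponential family of densities `exp ((y * θ - b θ) / φ + c y φ)` with respect to a base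
measure `ν` (for example Lebesgue or counting measure), for `θ` in an open interval `Θ`,
and the canonical link `g`, that is, the inverse of the mean function `b'`. -/
structure GLM where
  /-- the measure with respect to which the densities are taken -/
  ν : Measure ℝ
  sigmaFinite : SigmaFinite ν
  /-- the natural parameter space -/
  Θ : Set ℝ
  isOpen : IsOpen Θ
  ordConnected : Θ.OrdConnected
  /-- the cumulant function -/
  b : ℝ → ℝ
  /-- the normalising function -/
  c : ℝ → ℝ → ℝ
  /-- the dispersion parameter -/
  φ : ℝ
  φ_pos : 0 < φ
  measurable_c : Measurable fun y => c y φ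
  /-- every member of the family is a probability density -/
  lintegral_density : ∀ θ ∈ Θ,
    ∫⁻ y, ENNReal.ofReal (Real.exp ((y * θ - b θ) / φ + c y φ)) ∂ν = 1
  /-- the link function -/
  g : ℝ → ℝ
  /-- the link is canonical: it inverts the mean function `b'` -/
  g_deriv_b : ∀ θ ∈ Θ, g (deriv b θ) = θ

namespace GLM

variable (M : GLM) {p : ℕ}

/-- The inverse link `g⁻¹`; as the link is canonical, it is the mean function `b'`. -/
noncomputable def invLink (η : ℝ) : ℝ := deriv M.b η

/-- The weight `1 / g'`, where `g'` is taken at the mean `g⁻¹ η` that belongs to the linear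
predictor `η`. -/
noncomputable def weight (η : ℝ) : ℝ := (deriv M.g (M.invLink η))⁻¹

/-- The logarithm of the conditional density of a response `y` given the covariate `x`. -/
noncomputable def logDensity (y : ℝ) (x β : EuclideanSpace ℝ (Fin p)) : ℝ :=
  (y * inner ℝ x β - M.b (inner ℝ x β)) / M.φ + M.c y M.φ

/-- The pairs `(x i, y i)` are independent and identically distributed, and the conditional
density of `y i` given `x i` is that of the model with regression parameter `β₀`. -/
structure IsSample {Ω : Type*} [MeasurableSpace Ω] (P : Measure Ω)
    (β₀ : EuclideanSpace ℝ (Fin p))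
    (x : ℕ → Ω → EuclideanSpace ℝ (Fin p)) (y : ℕ → Ω → ℝ) : Prop where
  measurable_x : ∀ i, Measurable (x i)
  measurable_y : ∀ i, Measurable (y i)
  indep : iIndepFun (fun i ω => (x i ω, y i ω)) P
  identDistrib : ∀ i, IdentDistrib (fun ω => (x i ω, y i ω)) (fun ω => (x 0 ω, y 0 ω)) P P
  mem_param : ∀ᵐ ω ∂P, inner ℝ (x 0 ω) β₀ ∈ M.Θ
  law : P.map (fun ω => (x 0 ω, y 0 ω)) =
    ((P.map (x 0)).prod M.ν).withDensity
      fun z => ENNReal.ofReal (Real.exp (M.logDensity z.2 z.1 β₀))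

/-- The score function
`S_n(β) = (1/n) ∑ {y_i - g⁻¹(x_iᵀ β)} x_i / φ` of the first `n` observations. -/
noncomputable def score (n : ℕ) (xs : ℕ → EuclideanSpace ℝ (Fin p)) (ys : ℕ → ℝ)
    (β : EuclideanSpace ℝ (Fin p)) : EuclideanSpace ℝ (Fin p) :=
  (n : ℝ)⁻¹ • ∑ i ∈ Finset.range n, ((ys i - M.invLink (inner ℝ (xs i) β)) / M.φ) • xs i

/-- The sensitivity matrix (derivative of the score)
`- (1/n) ∑ x_i x_iᵀ / {φ g'}`, with `g'` taken at the mean that belongs to `x_iᵀ β`. -/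
noncomputable def sensitivity (n : ℕ) (xs : ℕ → EuclideanSpace ℝ (Fin p))
    (β : EuclideanSpace ℝ (Fin p)) : Matrix (Fin p) (Fin p) ℝ :=
  Matrix.of fun j k =>
    -((n : ℝ)⁻¹ * ∑ i ∈ Finset.range n, M.weight (inner ℝ (xs i) β) / M.φ * (xs i j * xs i k))

/-- The penalised log-likelihood
`(1/n) ∑ {y_i x_iᵀ β - b(x_iᵀ β)} / φ - lam * ‖β‖₁`. -/
noncomputable def penLogLik (n : ℕ) (xs : ℕ → EuclideanSpace ℝ (Fin p)) (ys : ℕ → ℝ) (lam : ℝ)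
    (β : EuclideanSpace ℝ (Fin p)) : ℝ :=
  (n : ℝ)⁻¹ * ∑ i ∈ Finset.range n,
    (ys i * inner ℝ (xs i) β - M.b (inner ℝ (xs i) β)) / M.φ - lam * l1Norm β

/-- The regression parameters for which all the first `n` densities are defined
(all vectors if `Θ` is the whole line). -/
def admissible (n : ℕ) (xs : ℕ → EuclideanSpace ℝ (Fin p)) : Set (EuclideanSpace ℝ (Fin p)) :=
  {β | ∀ i < n, inner ℝ (xs i) β ∈ M.Θ}

/-- `βhat` is a lasso estimate: it maximises the penalised log-likelihood. -/
def IsLasso (n : ℕ) (xs : ℕ → EuclideanSpace ℝ (Fin p)) (ys : ℕ → ℝ) (lam : ℝ)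
    (βhat : EuclideanSpace ℝ (Fin p)) : Prop :=
  βhat ∈ M.admissible n xs ∧ IsMaxOn (M.penLogLik n xs ys lam) (M.admissible n xs) βhat

/-- The bias-corrected (one-step Newton) estimate
`βhat + {- S_n'(βhat)}⁻¹ S_n(βhat)`. -/
noncomputable def biasCorrected (n : ℕ) (xs : ℕ → EuclideanSpace ℝ (Fin p)) (ys : ℕ → ℝ)
    (βhat : EuclideanSpace ℝ (Fin p)) : EuclideanSpace ℝ (Fin p) :=
  βhat + WithLp.toLp 2
    (Matrix.mulVec (-(M.sensitivity n xs βhat))⁻¹ (M.score n xs ys βhat).ofLp)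

/-- The matrix `E {x xᵀ / (φ g')}`, with `g'` taken at the mean that belongs to `xᵀ β₀`. -/
noncomputable def infoMatrix {Ω : Type*} [MeasurableSpace Ω] (P : Measure Ω)
    (β₀ : EuclideanSpace ℝ (Fin p)) (x : Ω → EuclideanSpace ℝ (Fin p)) :
    Matrix (Fin p) (Fin p) ℝ :=
  Matrix.of fun j k => ∫ ω, M.weight (inner ℝ (x ω) β₀) / M.φ * (x ω j * x ω k) ∂P

/-- The Fisher information matrix of one observation `(x, y)` at `β₀`: the second moment
matrix of the gradient in `β` of the log density. -/
noncomputable def fisherInformation {Ω : Type*} [MeasurableSpace Ω] (P : Measure Ω)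
    (β₀ : EuclideanSpace ℝ (Fin p)) (x : Ω → EuclideanSpace ℝ (Fin p)) (y : Ω → ℝ) :
    Matrix (Fin p) (Fin p) ℝ :=
  Matrix.of fun j k =>
    ∫ ω, gradient (M.logDensity (y ω) (x ω)) β₀ j * gradient (M.logDensity (y ω) (x ω)) β₀ k ∂P

/-- The condition on the score and on the link near the true parameter `β₀`, for a generic
observation `(x, y)`. -/
structure ScoreLinkCondition {Ω : Type*} [MeasurableSpace Ω] (P : Measure Ω)
    (β₀ : EuclideanSpace ℝ (Fin p)) (x : Ω → EuclideanSpace ℝ (Fin p)) (y : Ω → ℝ) : Prop where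
  score_eq_zero : ∫ ω, ((y ω - M.invLink (inner ℝ (x ω) β₀)) / M.φ) • x ω ∂P = 0
  nhds : ∃ δ > 0,
    (∀ᵐ ω ∂P, ∀ β, l1Norm (β - β₀) < δ → inner ℝ (x ω) β ∈ M.Θ) ∧
    (∀ β, l1Norm (β - β₀) < δ → ∃ c > 0, ∀ᵐ ω ∂P, c ≤ |M.weight (inner ℝ (x ω) β)|) ∧
    (∀ β, l1Norm (β - β₀) < δ → ∃ C, ∀ᵐ ω ∂P, |M.weight (inner ℝ (x ω) β)| ≤ C) ∧
    (∀ᵐ ω ∂P, ∀ β, l1Norm (β - β₀) < δ →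
      |M.weight (inner ℝ (x ω) β) - M.weight (inner ℝ (x ω) β₀)| ≤ |inner ℝ (x ω) (β - β₀)|)

end GLM

/-- The condition on the random design: its entries are `O_p(1)`, and, with probability tending
to one, the singular values of `n^(-1/2) X` lie between two positive constants. -/
structure DesignCondition {Ω : Type*} [MeasurableSpace Ω] {p : ℕ} (P : Measure Ω)
    (x : ℕ → Ω → EuclideanSpace ℝ (Fin p)) : Prop where
  entries : IsBigOP P (fun n ω => maxAbsEntry (designMatrix n fun i => x i ω)) fun _ => 1
  singularValues : ∃ l > 0, ∃ u > 0,
    Tendsto (fun n : ℕ => P {ω | ¬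
      (l ≤ minSingularValue ((Real.sqrt n)⁻¹ • designMatrix n fun i => x i ω) ∧
        maxSingularValue ((Real.sqrt n)⁻¹ • designMatrix n fun i => x i ω) ≤ u)})
      atTop (𝓝 0)

/-- The tuning parameter `(log p / n)^(1/2)`. -/
noncomputable def tuning (p n : ℕ) : ℝ := Real.sqrt (Real.log p / n)

/-- The condition on the sparsity `s₀` of `β₀` and on the rates of the estimators `βhat n`. -/
structure RateCondition {Ω : Type*} [MeasurableSpace Ω] {p : ℕ} (P : Measure Ω)
    (β₀ : EuclideanSpace ℝ (Fin p)) (x : ℕ → Ω → EuclideanSpace ℝ (Fin p))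
    (βhat : ℕ → Ω → EuclideanSpace ℝ (Fin p)) : Prop where
  /-- `s₀ = o(n^(1/2) / log p)`, without a division by `log 1 = 0` -/
  sparsity : (fun _ : ℕ => (numNonzero β₀ : ℝ) * Real.log p) =o[atTop] fun n : ℕ => Real.sqrt n
  estimation : IsBigOP P (fun n ω => l1Norm (βhat n ω - β₀))
    fun n => numNonzero β₀ * tuning p n
  prediction : IsBigOP P
    (fun n ω => (n : ℝ)⁻¹ *
      ‖Matrix.toEuclideanLin (designMatrix n fun i => x i ω) (βhat n ω - β₀)‖ ^ 2)
    fun n => numNonzero β₀ * tuning p n ^ 2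

/-!
For fixed dimension the rate condition says that the preliminary estimate is within
`O_p (n^(-1/2))` of `β₀`, and the theorem is the classical statement that one Newton step from such
an estimate is as good as solving the score equation. With `A = - S_n'(βhat)`,

`A (β^c - β₀) = S_n(β₀) + {A (βhat - β₀) + S_n(βhat) - S_n(β₀)}`,

and the bracket is a Taylor remainder of order `‖βhat - β₀‖² = O_p (1/n)`
(`GLM.norm_score_linearisation_le`). As `A` converges in probability to the information matrix `I`
and `√n S_n(β₀)` in distribution to `N(0, I)`, Slutsky's theorem yields the limit
`I⁻¹ N(0, I) = N(0, I⁻¹)` (`tendstoInDistribution_newtonStep`); consistency follows from it.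

The conditions enter as follows.

* The link inverts `b'`, so the response is nowhere degenerate, and the weight `1 / g'` is
  `b'' = Var / φ > 0` (`GLM.weight_eq_deriv_invLink`, `GLM.weight_pos`). Conditioning on the covariate
  then identifies `I` with the Fisher information
  (`GLM.IsSample.infoMatrix_eq_fisherInformation`) and with the covariance of the score.
* For independent identically distributed rows, the bound `O_p (1)` on the entries of the design
  means that the covariates are almost surely bounded (`exists_ae_norm_le`), and the lower bound on
  the singular values excludes that they lie in a hyperplane (`eq_zero_of_ae_inner_eq_zero`). This
  provides the moments that the limit theorems need, and the positive definiteness of `I`.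
* The Lipschitz bound on the weight controls the Taylor remainder and the distance between
  `S_n'(βhat)` and `S_n'(β₀)`; the law of large numbers applies to the latter.
-/

/-! ### The exponential family and its mean function -/

namespace GLM

variable (M : GLM)

/-- The member of the exponential family with natural parameter `θ`, as a measure. -/
noncomputable def responseLaw (θ : ℝ) : Measure ℝ :=
  M.ν.withDensity fun y => ENNReal.ofReal (Real.exp ((y * θ - M.b θ) / M.φ + M.c y M.φ))

/-- The measure with density `exp (c y φ)` with respect to the base measure. The family consists
of the exponential tilts of this measure, so that `b` is a rescaled cumulant generating function. -/
noncomputable def carrier : Measure ℝ :=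
  M.ν.withDensity fun y => ENNReal.ofReal (Real.exp (M.c y M.φ))

lemma isProbabilityMeasure_responseLaw {θ : ℝ} (hθ : θ ∈ M.Θ) :
    IsProbabilityMeasure (M.responseLaw θ) :=
  ⟨by rw [responseLaw, withDensity_apply _ MeasurableSet.univ, Measure.restrict_univ]
      exact M.lintegral_density θ hθ⟩

lemma lintegral_exp_carrier {θ : ℝ} (hθ : θ ∈ M.Θ) :
    ∫⁻ y, ENNReal.ofReal (Real.exp (θ / M.φ * y)) ∂M.carrier
      = ENNReal.ofReal (Real.exp (M.b θ / M.φ)) := by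
  have hc := M.measurable_c
  rw [carrier, lintegral_withDensity_eq_lintegral_mul _ (by fun_prop) (by fun_prop)]
  have h : ∀ y, ENNReal.ofReal (Real.exp (M.c y M.φ)) * ENNReal.ofReal (Real.exp (θ / M.φ * y))
      = ENNReal.ofReal (Real.exp (M.b θ / M.φ)) *
        ENNReal.ofReal (Real.exp ((y * θ - M.b θ) / M.φ + M.c y M.φ)) := by
    intro y
    rw [← ENNReal.ofReal_mul (by positivity), ← ENNReal.ofReal_mul (by positivity),
      ← Real.exp_add, ← Real.exp_add]
    congr 2
    ring
  simp only [Pi.mul_apply, h]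
  rw [lintegral_const_mul _ (by fun_prop), M.lintegral_density θ hθ, mul_one]

lemma integrable_exp_carrier {θ : ℝ} (hθ : θ ∈ M.Θ) :
    Integrable (fun y => Real.exp (θ / M.φ * id y)) M.carrier := by
  refine ⟨by fun_prop, ?_⟩
  rw [hasFiniteIntegral_iff_ofReal (ae_of_all _ fun y => by positivity)]
  simpa only [id] using (M.lintegral_exp_carrier hθ).trans_lt ENNReal.ofReal_lt_top

lemma mgf_carrier {θ : ℝ} (hθ : θ ∈ M.Θ) :
    mgf id M.carrier (θ / M.φ) = Real.exp (M.b θ / M.φ) := by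
  rw [mgf, integral_eq_lintegral_of_nonneg_ae (ae_of_all _ fun y => by positivity) (by fun_prop)]
  simp only [id]
  rw [M.lintegral_exp_carrier hθ, ENNReal.toReal_ofReal (by positivity)]

lemma b_eq_cgf {θ : ℝ} (hθ : θ ∈ M.Θ) : M.b θ = M.φ * cgf id M.carrier (θ / M.φ) := by
  rw [cgf, M.mgf_carrier hθ, Real.log_exp]
  field_simp [M.φ_pos.ne']

lemma div_mem_interior {θ : ℝ} (hθ : θ ∈ M.Θ) :
    θ / M.φ ∈ interior (integrableExpSet id M.carrier) := by
  have hφ := M.φ_pos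
  refine interior_maximal (s := integrableExpSet id M.carrier)
    (t := (fun t => t * M.φ) ⁻¹' M.Θ) ?_ (M.isOpen.preimage (by fun_prop)) ?_
  · intro t ht
    have := M.integrable_exp_carrier ht
    rwa [mul_div_cancel_right₀ _ hφ.ne'] at this
  · simpa [div_mul_cancel₀ _ hφ.ne'] using hθ

lemma responseLaw_eq_tilted {θ : ℝ} (hθ : θ ∈ M.Θ) :
    M.responseLaw θ = M.carrier.tilted (θ / M.φ * id ·) := by
  have hc := M.measurable_c
  have hm : ∫ y, Real.exp (θ / M.φ * id y) ∂M.carrier = Real.exp (M.b θ / M.φ) :=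
    M.mgf_carrier hθ
  rw [Measure.tilted, hm, carrier, responseLaw,
    ← withDensity_mul _ (by fun_prop) (by fun_prop)]
  congr 1
  ext y
  rw [Pi.mul_apply, ← Real.exp_sub, ← ENNReal.ofReal_mul (by positivity), ← Real.exp_add]
  congr 2
  simp only [id]
  ring

lemma memLp_responseLaw {θ : ℝ} (hθ : θ ∈ M.Θ) : MemLp id 2 (M.responseLaw θ) := by
  rw [M.responseLaw_eq_tilted hθ]
  exact_mod_cast memLp_tilted_mul (M.div_mem_interior hθ) 2

lemma analyticAt_b {θ : ℝ} (hθ : θ ∈ M.Θ) : AnalyticAt ℝ M.b θ := by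
  have h : AnalyticAt ℝ (fun t => M.φ * cgf id M.carrier (t / M.φ)) θ :=
    analyticAt_const.mul ((analyticAt_cgf (M.div_mem_interior hθ)).comp
      (f := fun t => t / M.φ) (analyticAt_id.div_const))
  refine h.congr ?_
  filter_upwards [M.isOpen.mem_nhds hθ] with t ht using (M.b_eq_cgf ht).symm

/-- The inverse link is the mean of the response. -/
lemma invLink_eq_cgf {θ : ℝ} (hθ : θ ∈ M.Θ) :
    M.invLink θ = deriv (cgf id M.carrier) (θ / M.φ) := by
  have hφ := M.φ_pos.ne'
  have h1 : HasDerivAt (fun t => M.φ * cgf id M.carrier (t / M.φ))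
      (M.φ * (deriv (cgf id M.carrier) (θ / M.φ) * (1 / M.φ))) θ := by
    have := (analyticAt_cgf (M.div_mem_interior hθ)).differentiableAt.hasDerivAt
    exact (HasDerivAt.comp θ this ((hasDerivAt_id θ).div_const M.φ)).const_mul _
  have h2 : HasDerivAt M.b (M.φ * (deriv (cgf id M.carrier) (θ / M.φ) * (1 / M.φ))) θ := by
    refine h1.congr_of_eventuallyEq ?_
    filter_upwards [M.isOpen.mem_nhds hθ] with t ht using M.b_eq_cgf ht
  rw [invLink, h2.deriv]
  field_simp

lemma integral_responseLaw {θ : ℝ} (hθ : θ ∈ M.Θ) :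
    ∫ y, y ∂M.responseLaw θ = M.invLink θ := by
  rw [M.invLink_eq_cgf hθ, M.responseLaw_eq_tilted hθ]
  exact integral_tilted_mul_self (M.div_mem_interior hθ)

lemma deriv_invLink {θ : ℝ} (hθ : θ ∈ M.Θ) :
    deriv M.invLink θ = Var[id; M.responseLaw θ] / M.φ := by
  rw [M.responseLaw_eq_tilted hθ, variance_tilted_mul (M.div_mem_interior hθ), iteratedDeriv_succ,
    iteratedDeriv_one]
  have hd : DifferentiableAt ℝ (deriv (cgf id M.carrier)) (θ / M.φ) :=
    (analyticAt_cgf (M.div_mem_interior hθ)).deriv.differentiableAt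
  have h1 := HasDerivAt.comp θ hd.hasDerivAt ((hasDerivAt_id θ).div_const M.φ)
  have h2 : M.invLink =ᶠ[𝓝 θ] fun t => deriv (cgf id M.carrier) (t / M.φ) := by
    filter_upwards [M.isOpen.mem_nhds hθ] with t ht using M.invLink_eq_cgf ht
  rw [h2.deriv_eq]
  refine h1.deriv.trans ?_
  ring

lemma analyticAt_invLink {θ : ℝ} (hθ : θ ∈ M.Θ) : AnalyticAt ℝ M.invLink θ :=
  (M.analyticAt_b hθ).deriv

/-- A response law with zero variance would be a point mass; as all laws of the family have the
same null sets, the mean would not depend on the parameter, and the mean function could not be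
inverted by the link. -/
lemma variance_responseLaw_pos {θ : ℝ} (hθ : θ ∈ M.Θ) : 0 < Var[id; M.responseLaw θ] := by
  have hprob := M.isProbabilityMeasure_responseLaw hθ
  refine lt_of_le_of_ne (variance_nonneg _ _) fun h0 => ?_
  have hae := ae_eq_integral_of_variance_eq_zero (M.memLp_responseLaw hθ) h0.symm
  have hm : ∀ t ∈ M.Θ, M.invLink t = M.invLink θ := by
    intro t ht
    have hprob' := M.isProbabilityMeasure_responseLaw ht
    have hac : M.responseLaw t ≪ M.responseLaw θ := by
      rw [M.responseLaw_eq_tilted ht, M.responseLaw_eq_tilted hθ]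
      exact (tilted_absolutelyContinuous _ _).trans
        (absolutelyContinuous_tilted (M.integrable_exp_carrier hθ))
    have hae' := hac.ae_le hae
    rw [← M.integral_responseLaw ht, integral_congr_ae (g := fun _ => M.invLink θ)]
    · simp
    · filter_upwards [hae'] with y hy
      rw [← M.integral_responseLaw hθ]
      exact hy
  have hΘ : M.Θ ⊆ {θ} := by
    intro t ht
    have h1 := M.g_deriv_b t ht
    have h2 := M.g_deriv_b θ hθ
    have h3 : deriv M.b t = deriv M.b θ := hm t ht
    rw [h3, h2] at h1
    exact h1.symm
  have hn : {θ} ∈ 𝓝 θ := mem_of_superset (M.isOpen.mem_nhds hθ) hΘ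
  have := (mem_interior_iff_mem_nhds.2 hn)
  simp at this

lemma deriv_invLink_pos {θ : ℝ} (hθ : θ ∈ M.Θ) : 0 < deriv M.invLink θ := by
  rw [M.deriv_invLink hθ]
  exact div_pos (M.variance_responseLaw_pos hθ) M.φ_pos

/-- By the inverse function theorem the weight is the derivative `b''` of the mean function. -/
lemma weight_eq_deriv_invLink {θ : ℝ} (hθ : θ ∈ M.Θ) : M.weight θ = deriv M.invLink θ := by
  have hs : HasStrictDerivAt M.invLink (deriv M.invLink θ) θ :=
    (M.analyticAt_invLink hθ).hasStrictDerivAt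
  have hg : ∀ᶠ t in 𝓝 θ, M.g (M.invLink t) = t := by
    filter_upwards [M.isOpen.mem_nhds hθ] with t ht using M.g_deriv_b t ht
  have := (hs.to_local_left_inverse (M.deriv_invLink_pos hθ).ne' hg).hasDerivAt.deriv
  rw [weight, this, inv_inv]

lemma weight_pos {θ : ℝ} (hθ : θ ∈ M.Θ) : 0 < M.weight θ := by
  rw [M.weight_eq_deriv_invLink hθ]
  exact M.deriv_invLink_pos hθ

lemma hasDerivAt_invLink {θ : ℝ} (hθ : θ ∈ M.Θ) : HasDerivAt M.invLink (M.weight θ) θ := by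
  rw [M.weight_eq_deriv_invLink hθ]
  exact (M.analyticAt_invLink hθ).differentiableAt.hasDerivAt

lemma continuousAt_weight {θ : ℝ} (hθ : θ ∈ M.Θ) : ContinuousAt M.weight θ := by
  refine (M.analyticAt_invLink hθ).deriv.continuousAt.congr ?_
  filter_upwards [M.isOpen.mem_nhds hθ] with t ht using (M.weight_eq_deriv_invLink ht).symm

lemma variance_responseLaw {θ : ℝ} (hθ : θ ∈ M.Θ) :
    Var[id; M.responseLaw θ] = M.φ * M.weight θ := by
  rw [M.weight_eq_deriv_invLink hθ, M.deriv_invLink hθ, mul_div_cancel₀ _ M.φ_pos.ne']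

lemma measurable_invLink : Measurable M.invLink := measurable_deriv _

lemma measurable_weight : Measurable M.weight :=
  ((measurable_deriv _).comp M.measurable_invLink).inv

end GLM

/-! ### Convergence in probability -/

section Convergence

variable {Ω : Type*} [MeasurableSpace Ω] {P : Measure Ω}

/-- Continuous mapping theorem for convergence in probability to a constant. -/
lemma tendstoInMeasure_comp_const {E F : Type*} [PseudoMetricSpace E] [PseudoMetricSpace F]
    {X : ℕ → Ω → E} {a : E} (hX : TendstoInMeasure P X atTop fun _ => a)
    {f : E → F} (hf : ContinuousAt f a) :
    TendstoInMeasure P (fun n ω => f (X n ω)) atTop fun _ => f a := by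
  rw [tendstoInMeasure_iff_dist] at hX ⊢
  intro ε hε
  obtain ⟨δ, hδ, h⟩ := Metric.continuousAt_iff.1 hf ε hε
  refine tendsto_of_tendsto_of_tendsto_of_le_of_le tendsto_const_nhds (hX δ hδ)
    (fun _ => zero_le) fun n => measure_mono fun ω hω => ?_
  by_contra hcon
  simp only [Set.mem_ofPred_eq, not_le] at hω hcon
  exact absurd (h hcon) (not_lt.2 hω)

lemma tendsto_measure_not_and {s t : ℕ → Ω → Prop}
    (hs : Tendsto (fun n => P {ω | ¬ s n ω}) atTop (𝓝 0))
    (ht : Tendsto (fun n => P {ω | ¬ t n ω}) atTop (𝓝 0)) :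
    Tendsto (fun n => P {ω | ¬ (s n ω ∧ t n ω)}) atTop (𝓝 0) := by
  have := hs.add ht
  rw [add_zero] at this
  refine tendsto_of_tendsto_of_tendsto_of_le_of_le tendsto_const_nhds this
    (fun _ => zero_le) fun n => (measure_mono fun ω hω => ?_).trans (measure_union_le _ _)
  by_cases h : s n ω
  · exact Or.inr fun h' => hω ⟨h, h'⟩
  · exact Or.inl h

/-- A sequence dominated, on events of probability tending to one, by a sequence that vanishes in
probability vanishes in probability. -/
lemma tendstoInMeasure_zero_of_le {E : Type*} [SeminormedAddCommGroup E] {X : ℕ → Ω → E}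
    {Y : ℕ → Ω → ℝ} (hY : TendstoInMeasure P Y atTop fun _ => 0)
    (hle : Tendsto (fun n => P {ω | ¬ ‖X n ω‖ ≤ Y n ω}) atTop (𝓝 0)) :
    TendstoInMeasure P X atTop fun _ => 0 := by
  rw [tendstoInMeasure_iff_norm] at hY ⊢
  intro ε hε
  have := hle.add (hY ε hε)
  rw [add_zero] at this
  refine tendsto_of_tendsto_of_tendsto_of_le_of_le tendsto_const_nhds this
    (fun _ => zero_le) fun n => (measure_mono fun ω hω => ?_).trans (measure_union_le _ _)
  simp only [sub_zero, Set.mem_ofPred_eq] at hω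
  by_cases h : ‖X n ω‖ ≤ Y n ω
  · right
    simp only [sub_zero, Set.mem_ofPred_eq, Real.norm_eq_abs]
    exact hω.trans (h.trans (le_abs_self _))
  · exact Or.inl h

lemma tendsto_measure_not_lt {X : ℕ → Ω → ℝ} (hX : TendstoInMeasure P X atTop fun _ => 0)
    {δ : ℝ} (hδ : 0 < δ) : Tendsto (fun n => P {ω | ¬ X n ω < δ}) atTop (𝓝 0) := by
  rw [tendstoInMeasure_iff_norm] at hX
  refine tendsto_of_tendsto_of_tendsto_of_le_of_le tendsto_const_nhds (hX δ hδ)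
    (fun _ => zero_le) fun n => measure_mono fun ω hω => ?_
  simp only [sub_zero, Set.mem_ofPred_eq, Real.norm_eq_abs, not_lt] at hω ⊢
  exact hω.trans (le_abs_self _)

lemma tendstoInMeasure_add_zero {E : Type*} [SeminormedAddCommGroup E]
    {X Y : ℕ → Ω → E} {a : E} (hX : TendstoInMeasure P X atTop fun _ => a)
    (hY : TendstoInMeasure P Y atTop fun _ => 0) :
    TendstoInMeasure P (fun n ω => X n ω + Y n ω) atTop fun _ => a := by
  rw [tendstoInMeasure_iff_norm] at hX hY ⊢
  intro ε hε
  have := (hX (ε / 2) (by positivity)).add (hY (ε / 2) (by positivity))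
  rw [add_zero] at this
  refine tendsto_of_tendsto_of_tendsto_of_le_of_le tendsto_const_nhds this
    (fun _ => zero_le) fun n => (measure_mono fun ω hω => ?_).trans (measure_union_le _ _)
  simp only [sub_zero, Set.mem_ofPred_eq, Set.mem_union] at hω ⊢
  by_contra! hcon
  have h1 : X n ω + Y n ω - a = (X n ω - a) + Y n ω := by abel
  have h2 := norm_add_le (X n ω - a) (Y n ω)
  rw [← h1] at h2
  linarith [hcon.1, hcon.2]

/-- A sequence that is `O_p (a n)`, multiplied by `r n = o (1 / a n)`, vanishes in probability. -/
lemma IsBigOP.tendstoInMeasure_mul {Z : ℕ → Ω → ℝ} {a r : ℕ → ℝ} (hZ : IsBigOP P Z a)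
    (hr : ∀ n, 0 ≤ r n) (hra : Tendsto (fun n => r n * a n) atTop (𝓝 0)) :
    TendstoInMeasure P (fun n ω => r n * Z n ω) atTop fun _ => 0 := by
  rw [tendstoInMeasure_iff_norm]
  intro ε hε
  rw [ENNReal.tendsto_nhds_zero]
  intro η hη
  obtain ⟨η', hη', hη'le⟩ : ∃ η' : ℝ, 0 < η' ∧ ENNReal.ofReal η' ≤ η := by
    rcases eq_or_ne η ⊤ with rfl | htop
    · exact ⟨1, one_pos, le_top⟩
    · exact ⟨η.toReal, ENNReal.toReal_pos hη.ne' htop, (ENNReal.ofReal_toReal htop).le⟩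
  obtain ⟨C, hC⟩ := hZ η' hη'
  have hC0 : Tendsto (fun n => C * (r n * a n)) atTop (𝓝 0) := by
    simpa using hra.const_mul C
  filter_upwards [hC, hC0.eventually_lt_const hε] with n hn hlt
  refine (measure_mono fun ω hω => ?_).trans (hn.trans hη'le)
  simp only [sub_zero, Set.mem_ofPred_eq, Real.norm_eq_abs, abs_mul, abs_of_nonneg (hr n)] at hω ⊢
  by_contra! hcon
  have := mul_le_mul_of_nonneg_left hcon (hr n)
  linarith

variable [IsProbabilityMeasure P]

/-- A normalised sequence can only converge in distribution if the sequence itself vanishes in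
probability. -/
lemma tendstoInMeasure_of_sqrt_smul_tendstoInDistribution {E Ω' : Type*} [NormedAddCommGroup E]
    [NormedSpace ℝ E] [MeasurableSpace E] [BorelSpace E] [SecondCountableTopology E]
    [MeasurableSpace Ω'] {μ' : Measure Ω'} [IsProbabilityMeasure μ'] {X : ℕ → Ω → E} {Z : Ω' → E}
    (h : TendstoInDistribution (fun (n : ℕ) ω => Real.sqrt n • X n ω) atTop Z (fun _ => P) μ') :
    TendstoInMeasure P X atTop fun _ => 0 := by
  have hr : Tendsto (fun n : ℕ => (Real.sqrt n)⁻¹) atTop (𝓝 0) :=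
    tendsto_inv_atTop_zero.comp (Real.tendsto_sqrt_atTop.comp tendsto_natCast_atTop_atTop)
  have hY : TendstoInMeasure P (fun (n : ℕ) (_ : Ω) => (Real.sqrt n)⁻¹) atTop fun _ => (0 : ℝ) :=
    tendstoInMeasure_of_tendsto_ae (fun n => by fun_prop) (ae_of_all _ fun _ => hr)
  have h2 := h.continuous_comp_prodMk_of_tendstoInMeasure_const
    (g := fun z : E × ℝ => z.2 • z.1) (by fun_prop) hY (fun n => by fun_prop)
  simp only [zero_smul] at h2
  rw [tendstoInMeasure_iff_norm]
  intro ε hε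
  have hcl : IsClosed {v : E | ε ≤ ‖v‖} := isClosed_le continuous_const continuous_norm
  have hlim := ProbabilityMeasure.limsup_measure_closed_le_of_tendsto h2.tendsto hcl
  have h0 : (μ'.map fun _ => (0 : E)) {v : E | ε ≤ ‖v‖} = 0 := by
    rw [Measure.map_apply measurable_const hcl.measurableSet]
    simp [not_le.2 hε]
  simp only [ProbabilityMeasure.coe_mk, h0] at hlim
  have ht := tendsto_of_le_liminf_of_limsup_le (zero_le (a := liminf _ atTop)) hlim
  refine ht.congr' ?_
  filter_upwards [eventually_gt_atTop 0] with n hn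
  rw [Measure.map_apply_of_aemeasurable (h2.forall_aemeasurable n) hcl.measurableSet]
  have hs : Real.sqrt n ≠ 0 := (Real.sqrt_pos.2 (by exact_mod_cast hn)).ne'
  simp [smul_smul, inv_mul_cancel₀ hs]

end Convergence

/-! ### Central limit theorem and one-step estimators -/

section Asymptotics

variable {Ω : Type*} [MeasurableSpace Ω] {P : Measure Ω} [IsProbabilityMeasure P] {p : ℕ}

/-- The multivariate central limit theorem, by Lévy's theorem and the central limit theorem for
the one-dimensional projections (the device of Cramér and Wold). -/
theorem tendstoInDistribution_inv_sqrt_smul_sum {ξ : ℕ → Ω → EuclideanSpace ℝ (Fin p)}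
    (hmeas : ∀ i, Measurable (ξ i)) (hindep : iIndepFun ξ P)
    (hident : ∀ i, IdentDistrib (ξ i) (ξ 0) P P)
    (hL2 : ∀ t, MemLp (fun ω => inner ℝ (ξ 0 ω) t) 2 P)
    (hmean : ∀ t, ∫ ω, inner ℝ (ξ 0 ω) t ∂P = 0)
    {S : Matrix (Fin p) (Fin p) ℝ} (hS : S.PosSemidef)
    (hcov : ∀ t : EuclideanSpace ℝ (Fin p),
      ∫ ω, (inner ℝ (ξ 0 ω) t) ^ 2 ∂P = t ⬝ᵥ S.mulVec t) :
    TendstoInDistribution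
      (fun (n : ℕ) ω => (Real.sqrt n)⁻¹ • ∑ i ∈ Finset.range n, ξ i ω) atTop id (fun _ => P)
      (multivariateGaussian 0 S) where
  forall_aemeasurable n := by fun_prop
  tendsto := by
    refine ProbabilityMeasure.tendsto_iff_tendsto_charFun.2 fun t => ?_
    have hvar : Var[fun ω => inner ℝ (ξ 0 ω) t; P] = t ⬝ᵥ S.mulVec t := by
      rw [variance_eq_integral (by fun_prop), hmean t]
      simpa using hcov t
    have hclt := tendstoInDistribution_inv_sqrt_mul_sum_sub (P := P)
      (X := fun i ω => inner ℝ (ξ i ω) t) (Y := id)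
      (P' := gaussianReal 0 (Var[fun ω => inner ℝ (ξ 0 ω) t; P]).toNNReal) (HasLaw.id)
      (hL2 t) (hindep.comp (fun _ v => inner ℝ v t) (fun _ => by fun_prop))
      (fun i => (hident i).comp (u := fun v => inner ℝ v t) (by fun_prop))
    have h1 := ProbabilityMeasure.tendsto_iff_tendsto_charFun.1 hclt.tendsto 1
    simp only [ProbabilityMeasure.coe_mk, hmean t, mul_zero, sub_zero, Measure.map_id] at h1 ⊢
    rw [charFun_gaussianReal] at h1
    rw [charFun_multivariateGaussian hS]
    have h0 : 0 ≤ t ⬝ᵥ S.mulVec t := hvar ▸ variance_nonneg _ _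
    convert h1 using 2 with n
    · rw [charFun_apply, charFun_apply, integral_map (by fun_prop) (by fun_prop),
        integral_map (by fun_prop) (by fun_prop)]
      simp [inner_smul_left, sum_inner, Finset.mul_sum]
    · rw [hvar, Real.coe_toNNReal _ h0]
      simp

lemma measurable_inv_mulVec :
    Measurable fun z : (Fin p → Fin p → ℝ) × EuclideanSpace ℝ (Fin p) =>
      WithLp.toLp 2 ((Matrix.of z.1)⁻¹.mulVec z.2.ofLp) := by
  have hdet : Measurable fun z : (Fin p → Fin p → ℝ) × EuclideanSpace ℝ (Fin p) =>
      (Matrix.of z.1).det := by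
    have : Continuous fun z : (Fin p → Fin p → ℝ) × EuclideanSpace ℝ (Fin p) =>
        (Matrix.of z.1).det := Continuous.matrix_det (by fun_prop)
    exact this.measurable
  have hadj : Measurable fun z : (Fin p → Fin p → ℝ) × EuclideanSpace ℝ (Fin p) =>
      WithLp.toLp 2 ((Matrix.of z.1).adjugate.mulVec z.2.ofLp) := by
    have : Continuous fun z : (Fin p → Fin p → ℝ) × EuclideanSpace ℝ (Fin p) =>
        WithLp.toLp 2 ((Matrix.of z.1).adjugate.mulVec z.2.ofLp) := by
      refine (PiLp.continuous_toLp 2 _).comp ?_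
      exact Continuous.matrix_mulVec (Continuous.matrix_adjugate (by fun_prop)) (by fun_prop)
    exact this.measurable
  have : (fun z : (Fin p → Fin p → ℝ) × EuclideanSpace ℝ (Fin p) =>
      WithLp.toLp 2 ((Matrix.of z.1)⁻¹.mulVec z.2.ofLp)) = fun z => (Matrix.of z.1).det⁻¹ •
        WithLp.toLp 2 ((Matrix.of z.1).adjugate.mulVec z.2.ofLp) := by
    ext z i
    simp [Matrix.inv_def, Matrix.smul_mulVec]
  rw [this]
  exact hdet.inv.smul hadj

lemma multivariateGaussian_map_inv_mulVec {S : Matrix (Fin p) (Fin p) ℝ} (hS : S.PosDef) :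
    (multivariateGaussian 0 S).map
      (fun v : EuclideanSpace ℝ (Fin p) => WithLp.toLp 2 (S⁻¹.mulVec v.ofLp)) =
      multivariateGaussian 0 S⁻¹ := by
  have hc : Continuous
      (fun v : EuclideanSpace ℝ (Fin p) => WithLp.toLp 2 (S⁻¹.mulVec v.ofLp)) :=
    (PiLp.continuous_toLp 2 _).comp (Continuous.matrix_mulVec continuous_const (by fun_prop))
  have hsymm : S⁻¹.transpose = S⁻¹ := by
    have := hS.inv.isHermitian
    rwa [Matrix.IsHermitian, Matrix.conjTranspose_eq_transpose_of_trivial] at this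
  have : IsProbabilityMeasure ((multivariateGaussian 0 S).map
      (fun v : EuclideanSpace ℝ (Fin p) => WithLp.toLp 2 (S⁻¹.mulVec v.ofLp))) :=
    Measure.isProbabilityMeasure_map (by fun_prop)
  refine Measure.ext_of_charFun ?_
  ext t
  have key : ∀ v : EuclideanSpace ℝ (Fin p),
      inner ℝ (WithLp.toLp 2 (S⁻¹.mulVec v.ofLp)) t =
        inner ℝ v (WithLp.toLp 2 (S⁻¹.mulVec t.ofLp)) := by
    intro v
    simp only [EuclideanSpace.inner_eq_star_dotProduct, star_trivial]
    rw [Matrix.dotProduct_mulVec, ← Matrix.mulVec_transpose, hsymm,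
      dotProduct_comm]
  rw [charFun_apply, integral_map (by fun_prop) (by fun_prop)]
  simp only [key]
  rw [← charFun_apply, charFun_multivariateGaussian hS.posSemidef,
    charFun_multivariateGaussian hS.inv.posSemidef]
  have hdet : IsUnit S.det := hS.det_pos.ne'.isUnit
  simp only [inner_zero_right]
  congr 3
  rw [Matrix.mulVec_mulVec, Matrix.mul_nonsing_inv _ hdet, Matrix.one_mulVec, dotProduct_comm]

/-- Asymptotic normality of a one-step Newton estimator. The linear map `A n` is the negative
derivative of the score at the preliminary estimate `βhat n`; if it linearises the score with
an error `o_p (n^(-1/2))`, then the error `βhat n - β₀` cancels in the Newton step, and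
what is left is `(A n)⁻¹` applied to the score at the true parameter. -/
theorem tendstoInDistribution_newtonStep {β₀ : EuclideanSpace ℝ (Fin p)}
    {βhat U Uhat : ℕ → Ω → EuclideanSpace ℝ (Fin p)} {A : ℕ → Ω → Fin p → Fin p → ℝ}
    {S : Matrix (Fin p) (Fin p) ℝ} (hS : S.PosDef)
    (hβ : ∀ n, AEMeasurable (βhat n) P) (hA : ∀ n, AEMeasurable (A n) P)
    (hU : ∀ n, AEMeasurable (Uhat n) P)
    (hclt : TendstoInDistribution (fun (n : ℕ) ω => Real.sqrt n • U n ω) atTop id (fun _ => P)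
      (multivariateGaussian 0 S))
    (hAS : TendstoInMeasure P A atTop fun _ => S)
    (hlin : TendstoInMeasure P (fun (n : ℕ) ω => Real.sqrt n •
      (WithLp.toLp 2 ((Matrix.of (A n ω)).mulVec (βhat n ω - β₀).ofLp) + Uhat n ω - U n ω))
      atTop fun _ => 0) :
    TendstoInDistribution (fun (n : ℕ) ω => Real.sqrt n •
      (βhat n ω + WithLp.toLp 2 ((Matrix.of (A n ω))⁻¹.mulVec (Uhat n ω).ofLp) - β₀))
      atTop id (fun _ => P) (multivariateGaussian 0 S⁻¹) := by
  -- the linearised score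
  set V : ℕ → Ω → EuclideanSpace ℝ (Fin p) := fun n ω => Real.sqrt n •
    (WithLp.toLp 2 ((Matrix.of (A n ω)).mulVec (βhat n ω - β₀).ofLp) + Uhat n ω) with hV
  have hAV : ∀ n, AEMeasurable
      (fun ω => WithLp.toLp 2 ((Matrix.of (A n ω)).mulVec (βhat n ω - β₀).ofLp)) P := by
    intro n
    have hc : Continuous fun z : (Fin p → Fin p → ℝ) × EuclideanSpace ℝ (Fin p) =>
        WithLp.toLp 2 ((Matrix.of z.1).mulVec z.2.ofLp) :=
      (PiLp.continuous_toLp 2 _).comp (Continuous.matrix_mulVec (by fun_prop) (by fun_prop))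
    exact hc.measurable.comp_aemeasurable ((hA n).prodMk ((hβ n).sub_const β₀))
  have hVm : ∀ n, AEMeasurable (V n) P := fun n => ((hAV n).add (hU n)).const_smul (Real.sqrt n)
  have hVlim : TendstoInDistribution V atTop id (fun _ => P) (multivariateGaussian 0 S) := by
    refine tendstoInDistribution_of_tendstoInMeasure_sub V id hclt ?_ hVm
    have hVU : V - (fun (n : ℕ) ω => Real.sqrt n • U n ω) = fun (n : ℕ) ω => Real.sqrt n •
        (WithLp.toLp 2 ((Matrix.of (A n ω)).mulVec (βhat n ω - β₀).ofLp) + Uhat n ω - U n ω) := by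
      ext1 n
      ext1 ω
      simp only [Pi.sub_apply, hV, ← smul_sub]
    rw [hVU]
    exact hlin
  have hdet : S.det ≠ 0 := hS.det_pos.ne'
  have hinvcont : ContinuousAt
      (fun B : Fin p → Fin p → ℝ => (Matrix.of.symm (Matrix.of B)⁻¹ : Fin p → Fin p → ℝ)) S := by
    have h1 : ContinuousAt (fun B : Fin p → Fin p → ℝ => (Matrix.of B).det) S :=
      (Continuous.matrix_det (by fun_prop)).continuousAt
    have h2 : ContinuousAt (fun B : Fin p → Fin p → ℝ =>
        (Matrix.of B).det⁻¹ • (Matrix.of B).adjugate) S :=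
      (h1.inv₀ hdet).smul (Continuous.matrix_adjugate (by fun_prop)).continuousAt
    simp only [Matrix.inv_def, Ring.inverse_eq_inv]
    exact h2
  have hAinv := tendstoInMeasure_comp_const hAS hinvcont
  have hAinvm : ∀ n, AEMeasurable
      (fun ω => (Matrix.of.symm (Matrix.of (A n ω))⁻¹ : Fin p → Fin p → ℝ)) P := by
    intro n
    have : Measurable (fun B : Fin p → Fin p → ℝ =>
        (Matrix.of.symm (Matrix.of B)⁻¹ : Fin p → Fin p → ℝ)) := by
      refine measurable_pi_lambda _ fun j => measurable_pi_lambda _ fun k => ?_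
      have h := (measurable_inv_mulVec (p := p)).comp
        (measurable_id.prodMk (measurable_const (a := EuclideanSpace.single k (1 : ℝ))))
      have h' : Measurable fun v : EuclideanSpace ℝ (Fin p) => v j := by fun_prop
      convert h'.comp h using 1
      ext B
      simp
    exact this.comp_aemeasurable (hA n)
  have hprod := hVlim.continuous_comp_prodMk_of_tendstoInMeasure_const
    (g := fun z : EuclideanSpace ℝ (Fin p) × (Fin p → Fin p → ℝ) =>
      WithLp.toLp 2 ((Matrix.of z.2).mulVec z.1.ofLp))
    ((PiLp.continuous_toLp 2 _).comp (Continuous.matrix_mulVec (by fun_prop) (by fun_prop)))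
    hAinv hAinvm
  have hlaw : TendstoInDistribution
      (fun (n : ℕ) ω => WithLp.toLp 2 ((Matrix.of (A n ω))⁻¹.mulVec (V n ω).ofLp)) atTop id
      (fun _ => P) (multivariateGaussian 0 S⁻¹) := by
    refine ⟨hprod.forall_aemeasurable, aemeasurable_id, ?_⟩
    refine hprod.tendsto.mono_right (le_of_eq (congrArg 𝓝 (Subtype.ext ?_)))
    simp only [Measure.map_id]
    exact multivariateGaussian_map_inv_mulVec hS
  refine tendstoInDistribution_of_tendstoInMeasure_sub _ id hlaw ?_ ?_
  · -- the Newton step and the linearised score agree as soon as `A n` is invertible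
    have hdetlim : TendstoInMeasure P (fun n ω => (Matrix.of (A n ω)).det) atTop
        fun _ => S.det :=
      tendstoInMeasure_comp_const (f := fun B : Fin p → Fin p → ℝ => (Matrix.of B).det) hAS
        (Continuous.matrix_det (by fun_prop)).continuousAt
    rw [tendstoInMeasure_iff_dist] at hdetlim
    refine tendstoInMeasure_zero_of_le (Y := fun _ _ => 0) ?_ ?_
    · rw [tendstoInMeasure_iff_dist]
      intro ε hε
      simp [not_le.2 hε]
    · refine tendsto_of_tendsto_of_tendsto_of_le_of_le tendsto_const_nhds
        (hdetlim |S.det| (abs_pos.2 hdet)) (fun _ => zero_le) fun n => measure_mono fun ω hω => ?_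
      simp only [Set.mem_ofPred_eq] at hω ⊢
      by_contra hcon
      have hunit : IsUnit (Matrix.of (A n ω)).det := by
        rw [isUnit_iff_ne_zero]
        intro h0
        rw [h0] at hcon
        simp [Real.dist_eq] at hcon
      apply hω
      have : (Matrix.of (A n ω))⁻¹.mulVec (V n ω).ofLp = (Real.sqrt n •
          (βhat n ω + WithLp.toLp 2 ((Matrix.of (A n ω))⁻¹.mulVec (Uhat n ω).ofLp) - β₀)).ofLp := by
        simp only [hV, WithLp.ofLp_smul, WithLp.ofLp_add, WithLp.ofLp_sub, Matrix.mulVec_smul,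
          Matrix.mulVec_add, Matrix.mulVec_mulVec, Matrix.nonsing_inv_mul _ hunit,
          Matrix.one_mulVec]
        congr 1
        abel
      simp [this]
  · intro n
    have := measurable_inv_mulVec.comp_aemeasurable ((hA n).prodMk (hU n))
    exact (((hβ n).add this).sub_const β₀).const_smul (Real.sqrt n)

end Asymptotics

/-! ### The score and the information of one observation -/

namespace GLM

variable (M : GLM) {p : ℕ}

/-- The standardised residual `(y - g⁻¹ (xᵀ β)) / φ` of an observation; the score contribution of
the observation is this number times `x`. -/
noncomputable def residual (y : ℝ) (x β : EuclideanSpace ℝ (Fin p)) : ℝ :=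
  (y - M.invLink (inner ℝ x β)) / M.φ

lemma lintegral_sq_responseLaw {θ : ℝ} (hθ : θ ∈ M.Θ) :
    ∫⁻ y, ENNReal.ofReal (((y - M.invLink θ) / M.φ) ^ 2) ∂M.responseLaw θ
      = ENNReal.ofReal (M.weight θ / M.φ) := by
  have hprob := M.isProbabilityMeasure_responseLaw hθ
  have hint : Integrable (fun y => ((y - M.invLink θ) / M.φ) ^ 2) (M.responseLaw θ) := by
    have h : MemLp (fun y => (y - M.invLink θ) / M.φ) 2 (M.responseLaw θ) := by
      simp only [div_eq_mul_inv]
      exact ((M.memLp_responseLaw hθ).sub (memLp_const (M.invLink θ))).mul_const _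
    exact h.integrable_sq
  rw [← ofReal_integral_eq_lintegral_ofReal hint (ae_of_all _ fun y => sq_nonneg _)]
  have hv := M.variance_responseLaw hθ
  rw [variance_eq_integral aemeasurable_id] at hv
  simp only [id, M.integral_responseLaw hθ] at hv
  simp only [div_pow, integral_div, hv]
  congr 1
  field_simp [M.φ_pos.ne']

lemma exists_measurable_eqOn_b : ∃ b' : ℝ → ℝ, Measurable b' ∧ Set.EqOn M.b b' M.Θ := by
  classical
  have hc : ContinuousOn M.b M.Θ := fun θ hθ => (M.analyticAt_b hθ).continuousAt.continuousWithinAt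
  refine ⟨M.Θ.piecewise M.b 0, hc.measurable_piecewise continuous_zero.continuousOn
    M.isOpen.measurableSet, fun θ hθ => ?_⟩
  simp [hθ]

lemma gradient_logDensity {y : ℝ} {x β : EuclideanSpace ℝ (Fin p)} (h : inner ℝ x β ∈ M.Θ) :
    gradient (M.logDensity y x) β = M.residual y x β • x := by
  have hb : HasDerivAt M.b (M.invLink (inner ℝ x β)) (inner ℝ x β) :=
    (M.analyticAt_b h).differentiableAt.hasDerivAt
  have hi : HasFDerivAt (fun β => inner ℝ x β) (innerSL ℝ x) β := (innerSL ℝ x).hasFDerivAt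
  have h1 := ((hi.const_mul y).sub (hb.comp_hasFDerivAt β hi)).mul_const (M.φ⁻¹)
  have h2 : HasFDerivAt (M.logDensity y x)
      (M.φ⁻¹ • (y • innerSL ℝ x - M.invLink (inner ℝ x β) • innerSL ℝ x)) β :=
    h1.add_const (M.c y M.φ)
  refine HasGradientAt.gradient ?_
  rw [hasGradientAt_iff_hasFDerivAt]
  have he : InnerProductSpace.toDual ℝ (EuclideanSpace ℝ (Fin p)) (M.residual y x β • x) =
      M.φ⁻¹ • (y • innerSL ℝ x - M.invLink (inner ℝ x β) • innerSL ℝ x) := by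
    ext v
    simp [residual]
    ring
  rw [he]
  exact h2

variable {Ω : Type*} [MeasurableSpace Ω] {P : Measure Ω}
  {β₀ : EuclideanSpace ℝ (Fin p)} {x : ℕ → Ω → EuclideanSpace ℝ (Fin p)} {y : ℕ → Ω → ℝ}

lemma measurable_residual (β : EuclideanSpace ℝ (Fin p)) :
    Measurable fun z : EuclideanSpace ℝ (Fin p) × ℝ => M.residual z.2 z.1 β := by
  have := M.measurable_invLink
  unfold residual
  fun_prop

namespace IsSample

variable {M}

lemma indep_x (hs : M.IsSample P β₀ x y) : iIndepFun x P :=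
  hs.indep.comp (fun _ => Prod.fst) fun _ => measurable_fst

lemma identDistrib_x (hs : M.IsSample P β₀ x y) (i : ℕ) : IdentDistrib (x i) (x 0) P P :=
  (hs.identDistrib i).comp measurable_fst

lemma ae_weight_pos (hs : M.IsSample P β₀ x y) :
    ∀ᵐ ω ∂P, 0 < M.weight (inner ℝ (x 0 ω) β₀) := by
  filter_upwards [hs.mem_param] with ω h using M.weight_pos h

lemma measurable_residual_comp (hs : M.IsSample P β₀ x y) (i : ℕ) :
    Measurable fun ω => M.residual (y i ω) (x i ω) β₀ :=
  (M.measurable_residual β₀).comp ((hs.measurable_x i).prodMk (hs.measurable_y i))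

variable [IsProbabilityMeasure P]

/-- Conditionally on the covariate, the squared standardised residual has mean `weight / φ`. -/
lemma lintegral_sq_residual_mul (hs : M.IsSample P β₀ x y)
    {h : EuclideanSpace ℝ (Fin p) → ENNReal} (hh : Measurable h) :
    ∫⁻ ω, ENNReal.ofReal (M.residual (y 0 ω) (x 0 ω) β₀ ^ 2) * h (x 0 ω) ∂P =
      ∫⁻ ω, ENNReal.ofReal (M.weight (inner ℝ (x 0 ω) β₀) / M.φ) * h (x 0 ω) ∂P := by
  have := M.sigmaFinite
  have hx := hs.measurable_x 0
  have hy := hs.measurable_y 0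
  have hw := M.measurable_weight
  have hc := M.measurable_c
  have hr := M.measurable_residual β₀
  obtain ⟨b', hb', hbb'⟩ := M.exists_measurable_eqOn_b
  have hmem : ∀ᵐ v ∂P.map (x 0), inner ℝ v β₀ ∈ M.Θ := by
    rw [ae_map_iff hx.aemeasurable]
    · exact hs.mem_param
    · exact (M.isOpen.preimage (by fun_prop : Continuous fun v : EuclideanSpace ℝ (Fin p) =>
        inner ℝ v β₀)).measurableSet
  have hprob : IsProbabilityMeasure (P.map (x 0)) :=
    Measure.isProbabilityMeasure_map hx.aemeasurable
  set f : EuclideanSpace ℝ (Fin p) × ℝ → ENNReal := fun z => ENNReal.ofReal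
    (Real.exp ((z.2 * inner ℝ z.1 β₀ - b' (inner ℝ z.1 β₀)) / M.φ + M.c z.2 M.φ)) with hf
  have hfm : Measurable f := by fun_prop
  have hlaw : P.map (fun ω => (x 0 ω, y 0 ω)) = ((P.map (x 0)).prod M.ν).withDensity f := by
    rw [hs.law]
    refine withDensity_congr_ae ?_
    have hq : ∀ᵐ z ∂(P.map (x 0)).prod M.ν, inner ℝ z.1 β₀ ∈ M.Θ :=
      Measure.quasiMeasurePreserving_fst.ae hmem
    filter_upwards [hq] with z hz
    simp only [hf, logDensity, hbb' hz]
  have hF : Measurable fun z : EuclideanSpace ℝ (Fin p) × ℝ =>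
      ENNReal.ofReal (M.residual z.2 z.1 β₀ ^ 2) * h z.1 := by fun_prop
  have hG : Measurable fun v : EuclideanSpace ℝ (Fin p) =>
      ENNReal.ofReal (M.weight (inner ℝ v β₀) / M.φ) * h v := by fun_prop
  rw [← lintegral_map (f := fun z : EuclideanSpace ℝ (Fin p) × ℝ =>
      ENNReal.ofReal (M.residual z.2 z.1 β₀ ^ 2) * h z.1) hF (hx.prodMk hy), hlaw,
    lintegral_withDensity_eq_lintegral_mul _ hfm hF,
    lintegral_prod _ (hfm.mul hF).aemeasurable, ← lintegral_map hG hx]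
  refine lintegral_congr_ae ?_
  filter_upwards [hmem] with v hv
  rw [← M.lintegral_sq_responseLaw hv, responseLaw,
    lintegral_withDensity_eq_lintegral_mul _ (by fun_prop) (by fun_prop),
    ← lintegral_mul_const _ (by fun_prop)]
  refine lintegral_congr fun t => ?_
  simp only [Pi.mul_apply, hf, hbb' hv, residual, mul_assoc]

variable {B C : ℝ}

lemma integrable_weight_mul (hs : M.IsSample P β₀ x y)
    (hB : ∀ᵐ ω ∂P, ‖x 0 ω‖ ≤ B) (hC : ∀ᵐ ω ∂P, |M.weight (inner ℝ (x 0 ω) β₀)| ≤ C)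
    (s t : EuclideanSpace ℝ (Fin p)) :
    Integrable (fun ω => M.weight (inner ℝ (x 0 ω) β₀) / M.φ *
      (inner ℝ (x 0 ω) s * inner ℝ (x 0 ω) t)) P := by
  have hx := hs.measurable_x 0
  have hw := M.measurable_weight
  refine Integrable.of_bound (Measurable.aestronglyMeasurable (by fun_prop))
    (C / M.φ * (B * ‖s‖ * (B * ‖t‖))) ?_
  filter_upwards [hB, hC] with ω h1 h2
  have hφ := M.φ_pos
  rw [Real.norm_eq_abs, abs_mul, abs_mul, abs_div, abs_of_pos hφ]
  have hs' := (abs_real_inner_le_norm (x 0 ω) s).trans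
    (mul_le_mul_of_nonneg_right h1 (norm_nonneg s))
  have ht' := (abs_real_inner_le_norm (x 0 ω) t).trans
    (mul_le_mul_of_nonneg_right h1 (norm_nonneg t))
  have hC0 : 0 ≤ C := (abs_nonneg _).trans h2
  have := (abs_nonneg _).trans hs'
  gcongr

lemma lintegral_sq_residual_inner (hs : M.IsSample P β₀ x y) (t : EuclideanSpace ℝ (Fin p)) :
    ∫⁻ ω, ENNReal.ofReal ((M.residual (y 0 ω) (x 0 ω) β₀ * inner ℝ (x 0 ω) t) ^ 2) ∂P =
      ∫⁻ ω, ENNReal.ofReal (M.weight (inner ℝ (x 0 ω) β₀) / M.φ *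
        (inner ℝ (x 0 ω) t * inner ℝ (x 0 ω) t)) ∂P := by
  have h := hs.lintegral_sq_residual_mul
    (h := fun v => ENNReal.ofReal (inner ℝ v t * inner ℝ v t)) (by fun_prop)
  have hφ := M.φ_pos
  calc _ = _ := by
        refine lintegral_congr fun ω => ?_
        rw [mul_pow, ENNReal.ofReal_mul (sq_nonneg _), sq (inner ℝ (x 0 ω) t)]
    _ = _ := h
    _ = _ := by
        refine lintegral_congr_ae ?_
        filter_upwards [hs.ae_weight_pos] with ω hω
        rw [ENNReal.ofReal_mul (p := M.weight (inner ℝ (x 0 ω) β₀) / M.φ) (by positivity)]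

lemma memLp_residual_inner (hs : M.IsSample P β₀ x y)
    (hB : ∀ᵐ ω ∂P, ‖x 0 ω‖ ≤ B) (hC : ∀ᵐ ω ∂P, |M.weight (inner ℝ (x 0 ω) β₀)| ≤ C)
    (t : EuclideanSpace ℝ (Fin p)) :
    MemLp (fun ω => M.residual (y 0 ω) (x 0 ω) β₀ * inner ℝ (x 0 ω) t) 2 P := by
  have hx := hs.measurable_x 0
  have hr := hs.measurable_residual_comp 0
  rw [memLp_two_iff_integrable_sq (Measurable.aestronglyMeasurable (by fun_prop))]
  refine ⟨Measurable.aestronglyMeasurable (by fun_prop), ?_⟩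
  rw [hasFiniteIntegral_iff_ofReal (ae_of_all _ fun ω => sq_nonneg _),
    hs.lintegral_sq_residual_inner t]
  exact (hs.integrable_weight_mul hB hC t t).lintegral_lt_top

lemma integral_sq_residual_inner (hs : M.IsSample P β₀ x y) (t : EuclideanSpace ℝ (Fin p)) :
    ∫ ω, (M.residual (y 0 ω) (x 0 ω) β₀ * inner ℝ (x 0 ω) t) ^ 2 ∂P =
      ∫ ω, M.weight (inner ℝ (x 0 ω) β₀) / M.φ * (inner ℝ (x 0 ω) t * inner ℝ (x 0 ω) t) ∂P := by
  have hx := hs.measurable_x 0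
  have hr := hs.measurable_residual_comp 0
  have hw := M.measurable_weight
  have hφ := M.φ_pos
  rw [integral_eq_lintegral_of_nonneg_ae (ae_of_all _ fun ω => sq_nonneg _)
      (Measurable.aestronglyMeasurable (by fun_prop)),
    integral_eq_lintegral_of_nonneg_ae _ (Measurable.aestronglyMeasurable (by fun_prop)),
    hs.lintegral_sq_residual_inner t]
  filter_upwards [hs.ae_weight_pos] with ω hω
  have := mul_self_nonneg (inner ℝ (x 0 ω) t)
  simp only [Pi.zero_apply]
  positivity

/-- The conditional variance identity in its bilinear form, by polarisation. -/
lemma integral_residual_inner_mul (hs : M.IsSample P β₀ x y)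
    (hB : ∀ᵐ ω ∂P, ‖x 0 ω‖ ≤ B) (hC : ∀ᵐ ω ∂P, |M.weight (inner ℝ (x 0 ω) β₀)| ≤ C)
    (s t : EuclideanSpace ℝ (Fin p)) :
    ∫ ω, (M.residual (y 0 ω) (x 0 ω) β₀ * inner ℝ (x 0 ω) s) *
        (M.residual (y 0 ω) (x 0 ω) β₀ * inner ℝ (x 0 ω) t) ∂P =
      ∫ ω, M.weight (inner ℝ (x 0 ω) β₀) / M.φ * (inner ℝ (x 0 ω) s * inner ℝ (x 0 ω) t) ∂P := by
  have h1 := hs.integral_sq_residual_inner (s + t)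
  have h2 := hs.integral_sq_residual_inner (s - t)
  have i1 := (hs.memLp_residual_inner hB hC (s + t)).integrable_sq
  have i2 := (hs.memLp_residual_inner hB hC (s - t)).integrable_sq
  have j1 := hs.integrable_weight_mul hB hC (s + t) (s + t)
  have j2 := hs.integrable_weight_mul hB hC (s - t) (s - t)
  have e : ∫ ω, ((M.residual (y 0 ω) (x 0 ω) β₀ * inner ℝ (x 0 ω) (s + t)) ^ 2 -
      (M.residual (y 0 ω) (x 0 ω) β₀ * inner ℝ (x 0 ω) (s - t)) ^ 2) / 4 ∂P =
      ∫ ω, (M.weight (inner ℝ (x 0 ω) β₀) / M.φ *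
        (inner ℝ (x 0 ω) (s + t) * inner ℝ (x 0 ω) (s + t)) -
      M.weight (inner ℝ (x 0 ω) β₀) / M.φ *
        (inner ℝ (x 0 ω) (s - t) * inner ℝ (x 0 ω) (s - t))) / 4 ∂P := by
    rw [integral_div, integral_div, integral_sub i1 i2, integral_sub j1 j2, h1, h2]
  convert e using 3 with ω ω <;> rw [inner_add_right, inner_sub_right] <;> ring

lemma infoMatrix_eq_fisherInformation (hs : M.IsSample P β₀ x y)
    (hB : ∀ᵐ ω ∂P, ‖x 0 ω‖ ≤ B) (hC : ∀ᵐ ω ∂P, |M.weight (inner ℝ (x 0 ω) β₀)| ≤ C) :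
    M.infoMatrix P β₀ (x 0) = M.fisherInformation P β₀ (x 0) (y 0) := by
  ext j k
  have h := hs.integral_residual_inner_mul hB hC (EuclideanSpace.single j 1)
    (EuclideanSpace.single k 1)
  simp only [EuclideanSpace.inner_single_right, one_mul, conj_trivial] at h
  simp only [infoMatrix, fisherInformation, Matrix.of_apply]
  rw [← h]
  refine integral_congr_ae ?_
  filter_upwards [hs.mem_param] with ω hω
  simp [M.gradient_logDensity hω]

lemma dotProduct_infoMatrix_mulVec (hs : M.IsSample P β₀ x y)
    (hB : ∀ᵐ ω ∂P, ‖x 0 ω‖ ≤ B) (hC : ∀ᵐ ω ∂P, |M.weight (inner ℝ (x 0 ω) β₀)| ≤ C)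
    (t : EuclideanSpace ℝ (Fin p)) :
    t ⬝ᵥ (M.infoMatrix P β₀ (x 0)).mulVec t =
      ∫ ω, M.weight (inner ℝ (x 0 ω) β₀) / M.φ * (inner ℝ (x 0 ω) t * inner ℝ (x 0 ω) t) ∂P := by
  have hint : ∀ j k : Fin p, Integrable (fun ω => M.weight (inner ℝ (x 0 ω) β₀) / M.φ *
      (x 0 ω j * x 0 ω k)) P := by
    intro j k
    have := hs.integrable_weight_mul hB hC (EuclideanSpace.single j 1) (EuclideanSpace.single k 1)
    simpa only [EuclideanSpace.inner_single_right, one_mul, conj_trivial] using this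
  simp only [dotProduct, Matrix.mulVec, infoMatrix, Matrix.of_apply]
  have hexp : ∀ ω, M.weight (inner ℝ (x 0 ω) β₀) / M.φ *
      (inner ℝ (x 0 ω) t * inner ℝ (x 0 ω) t) = ∑ j, ∑ k, t j *
        (M.weight (inner ℝ (x 0 ω) β₀) / M.φ * (x 0 ω j * x 0 ω k) * t k) := by
    intro ω
    have : inner ℝ (x 0 ω) t = ∑ j, x 0 ω j * t j := by
      simp [PiLp.inner_apply, mul_comm]
    rw [this, Finset.sum_mul_sum, Finset.mul_sum]
    refine Finset.sum_congr rfl fun j _ => ?_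
    rw [Finset.mul_sum]
    exact Finset.sum_congr rfl fun k _ => by ring
  simp only [hexp]
  rw [integral_finsetSum _ fun j _ => integrable_finsetSum _ fun k _ =>
    ((hint j k).mul_const _).const_mul _]
  refine Finset.sum_congr rfl fun j _ => ?_
  rw [integral_finsetSum _ fun k _ => ((hint j k).mul_const _).const_mul _, Finset.mul_sum]
  exact Finset.sum_congr rfl fun k _ => by rw [integral_const_mul, integral_mul_const]

/-- The information matrix is positive definite as soon as the covariate is not concentrated on a
hyperplane. -/
lemma posDef_infoMatrix (hs : M.IsSample P β₀ x y)
    (hB : ∀ᵐ ω ∂P, ‖x 0 ω‖ ≤ B) (hC : ∀ᵐ ω ∂P, |M.weight (inner ℝ (x 0 ω) β₀)| ≤ C)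
    (hx : ∀ t, (∀ᵐ ω ∂P, inner ℝ (x 0 ω) t = 0) → t = 0) :
    (M.infoMatrix P β₀ (x 0)).PosDef := by
  have hφ := M.φ_pos
  refine Matrix.PosDef.of_dotProduct_mulVec_pos ?_ fun t ht => ?_
  · ext j k
    simp [infoMatrix, mul_comm (x 0 _ j)]
  · have h := hs.dotProduct_infoMatrix_mulVec hB hC (WithLp.toLp 2 t)
    simp only [star_trivial]
    rw [show t ⬝ᵥ (M.infoMatrix P β₀ (x 0)).mulVec t = _ from h]
    have hnn : 0 ≤ᵐ[P] fun ω => M.weight (inner ℝ (x 0 ω) β₀) / M.φ *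
        (inner ℝ (x 0 ω) (WithLp.toLp 2 t) * inner ℝ (x 0 ω) (WithLp.toLp 2 t)) := by
      filter_upwards [hs.ae_weight_pos] with ω hω
      have := mul_self_nonneg (inner ℝ (x 0 ω) (WithLp.toLp 2 t))
      simp only [Pi.zero_apply]
      positivity
    refine lt_of_le_of_ne (integral_nonneg_of_ae hnn) fun h0 => ht ?_
    have := (integral_eq_zero_iff_of_nonneg_ae hnn (hs.integrable_weight_mul hB hC _ _)).1 h0.symm
    have ht0 : WithLp.toLp 2 t = (0 : EuclideanSpace ℝ (Fin p)) := by
      refine hx _ ?_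
      filter_upwards [this, hs.ae_weight_pos] with ω h1 h2
      simpa [h2.ne', hφ.ne'] using h1
    exact congrArg WithLp.ofLp ht0

/-- The central limit theorem for the score at the true parameter. -/
lemma tendstoInDistribution_score (hs : M.IsSample P β₀ x y)
    (hB : ∀ᵐ ω ∂P, ‖x 0 ω‖ ≤ B) (hC : ∀ᵐ ω ∂P, |M.weight (inner ℝ (x 0 ω) β₀)| ≤ C)
    (hmean : ∫ ω, M.residual (y 0 ω) (x 0 ω) β₀ • x 0 ω ∂P = 0)
    (hpos : (M.infoMatrix P β₀ (x 0)).PosSemidef) :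
    TendstoInDistribution
      (fun (n : ℕ) ω => Real.sqrt n • M.score n (fun i => x i ω) (fun i => y i ω) β₀) atTop id
      (fun _ => P) (multivariateGaussian 0 (M.infoMatrix P β₀ (x 0))) := by
  have hx := hs.measurable_x
  have hr := hs.measurable_residual_comp
  have hmeas : Measurable fun z : EuclideanSpace ℝ (Fin p) × ℝ =>
      M.residual z.2 z.1 β₀ • z.1 := (M.measurable_residual β₀).smul measurable_fst
  have hinner : ∀ (ω : Ω) (t : EuclideanSpace ℝ (Fin p)),
      inner ℝ (M.residual (y 0 ω) (x 0 ω) β₀ • x 0 ω) t =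
        M.residual (y 0 ω) (x 0 ω) β₀ * inner ℝ (x 0 ω) t := fun ω t => by
    rw [real_inner_smul_left]
  have hint : Integrable (fun ω => M.residual (y 0 ω) (x 0 ω) β₀ • x 0 ω) P := by
    have hrL : Integrable (fun ω => M.residual (y 0 ω) (x 0 ω) β₀ ^ 2) P := by
      refine ⟨((hr 0).pow_const 2).aestronglyMeasurable, ?_⟩
      rw [hasFiniteIntegral_iff_ofReal (ae_of_all _ fun ω => sq_nonneg _)]
      have h := hs.lintegral_sq_residual_mul (h := fun _ => 1) measurable_const
      simp only [mul_one] at h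
      rw [h]
      have hw := M.measurable_weight
      have hx0 := hx 0
      refine (Integrable.of_bound (C := C / M.φ)
        (Measurable.aestronglyMeasurable (by fun_prop)) ?_).lintegral_lt_top
      filter_upwards [hC] with ω hω
      rw [Real.norm_eq_abs, abs_div, abs_of_pos M.φ_pos]
      have := M.φ_pos
      gcongr
    have hrI := ((memLp_two_iff_integrable_sq (hr 0).aestronglyMeasurable).2 hrL).integrable
      (by norm_num)
    refine (hrI.norm.mul_const B).mono' ((hr 0).smul (hx 0)).aestronglyMeasurable ?_
    filter_upwards [hB] with ω hω
    rw [norm_smul]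
    gcongr
  have hclt := tendstoInDistribution_inv_sqrt_smul_sum (P := P)
    (ξ := fun i ω => M.residual (y i ω) (x i ω) β₀ • x i ω)
    (fun i => (hr i).smul (hx i)) (hs.indep.comp (fun _ z => M.residual z.2 z.1 β₀ • z.1)
      fun _ => hmeas) (fun i => (hs.identDistrib i).comp hmeas)
    (fun t => by simpa only [hinner] using hs.memLp_residual_inner hB hC t)
    (fun t => by
      rw [integral_congr_ae (ae_of_all _ fun ω => (real_inner_comm _ _).symm),
        integral_inner hint t, hmean, inner_zero_right])
    hpos
    (fun t => by
      simp only [hinner]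
      rw [hs.integral_sq_residual_inner t, hs.dotProduct_infoMatrix_mulVec hB hC t])
  convert hclt using 3 with n ω
  rw [score, smul_smul]
  congr 1
  rw [← div_eq_mul_inv, Real.sqrt_div_self', one_div]

end IsSample

end GLM

/-! ### Consequences of the design condition, and regular covariates -/

lemma norm_le_l1Norm {p : ℕ} (v : EuclideanSpace ℝ (Fin p)) : ‖v‖ ≤ l1Norm v := by
  have h : v = ∑ j, v j • EuclideanSpace.single j (1 : ℝ) := by
    ext k
    simp [Pi.single_apply]
  calc ‖v‖ = ‖∑ j, v j • EuclideanSpace.single j (1 : ℝ)‖ := by rw [← h]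
    _ ≤ ∑ j, ‖v j • EuclideanSpace.single j (1 : ℝ)‖ := norm_sum_le _ _
    _ = l1Norm v := by simp [l1Norm, norm_smul]

lemma l1Norm_nonneg {p : ℕ} (v : EuclideanSpace ℝ (Fin p)) : 0 ≤ l1Norm v :=
  Finset.sum_nonneg fun _ _ => abs_nonneg _

lemma continuous_l1Norm {p : ℕ} : Continuous (l1Norm (p := p)) := by
  unfold l1Norm
  fun_prop

section Design

variable {Ω : Type*} [MeasurableSpace Ω] {P : Measure Ω} {p : ℕ}
  {x : ℕ → Ω → EuclideanSpace ℝ (Fin p)}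

lemma le_maxAbsEntry {m : ℕ} (A : Matrix (Fin m) (Fin p) ℝ) (i : Fin m) (j : Fin p) :
    |A i j| ≤ maxAbsEntry A :=
  (le_ciSup (f := fun j => |A i j|) (Set.finite_range _).bddAbove j).trans
    (le_ciSup (f := fun i => ⨆ j, |A i j|) (Set.finite_range _).bddAbove i)

/-- For independent and identically distributed rows, a maximal entry that stays bounded in
probability forces every row to be bounded almost surely: the probability that the first `n` rows
are bounded by `C` is the `n`-th power of the probability that one of them is. -/
lemma exists_ae_norm_le [IsProbabilityMeasure P] (hx : ∀ i, Measurable (x i))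
    (hindep : iIndepFun x P) (hident : ∀ i, IdentDistrib (x i) (x 0) P P)
    (hO : IsBigOP P (fun n ω => maxAbsEntry (designMatrix n fun i => x i ω)) fun _ => 1) :
    ∃ B : ℝ, 0 ≤ B ∧ ∀ᵐ ω ∂P, ∀ i, ‖x i ω‖ ≤ B := by
  obtain ⟨C, hC⟩ := hO (1 / 2) (by norm_num)
  set s : Set (EuclideanSpace ℝ (Fin p)) := {v | ∀ j, |v j| ≤ C} with hs
  have hsm : MeasurableSet s := by
    rw [hs, Set.ofPred_forall]
    refine MeasurableSet.iInter fun j => measurableSet_le ?_ measurable_const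
    fun_prop
  have hpow : ∀ n : ℕ, P (⋂ i ∈ Finset.range n, x i ⁻¹' s) = P (x 0 ⁻¹' s) ^ n := by
    intro n
    rw [hindep.measure_inter_preimage_eq_mul (Finset.range n) (fun _ _ => hsm),
      Finset.prod_congr rfl fun i _ => (hident i).measure_mem_eq hsm]
    simp
  have hhalf : ∀ᶠ n : ℕ in atTop, ENNReal.ofReal (1 / 2) ≤ P (x 0 ⁻¹' s) ^ n := by
    filter_upwards [hC] with n hn
    have hm : MeasurableSet (⋂ i ∈ Finset.range n, x i ⁻¹' s) :=
      Finset.measurableSet_biInter _ fun i _ => hx i hsm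
    have hsub : (⋂ i ∈ Finset.range n, x i ⁻¹' s)ᶜ ⊆
        {ω | C * 1 < |maxAbsEntry (designMatrix n fun i => x i ω)|} := by
      intro ω hω
      simp only [hs, Set.mem_compl_iff, Set.mem_iInter, Finset.mem_range, Set.mem_preimage,
        Set.mem_ofPred_eq] at hω ⊢
      push Not at hω
      obtain ⟨i, hi, j, hj⟩ := hω
      have := le_maxAbsEntry (designMatrix n fun i => x i ω) ⟨i, hi⟩ j
      simp only [designMatrix, Matrix.of_apply] at this
      rw [mul_one]
      exact hj.trans_le (this.trans (le_abs_self _))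
    have h1 := (measure_mono hsub).trans hn
    rw [prob_compl_eq_one_sub hm, hpow] at h1
    have h2 := tsub_le_iff_right.1 h1
    have h3 : (1 : ENNReal) = ENNReal.ofReal (1 / 2) + ENNReal.ofReal (1 / 2) := by
      rw [← ENNReal.ofReal_add (by norm_num) (by norm_num)]
      norm_num
    rw [h3] at h2
    exact (ENNReal.add_le_add_iff_left ENNReal.ofReal_ne_top).1 h2
  have hone : P (x 0 ⁻¹' s) = 1 := by
    by_contra hne
    have hlt : P (x 0 ⁻¹' s) < 1 := lt_of_le_of_ne prob_le_one hne
    have h0 := ENNReal.tendsto_pow_atTop_nhds_zero_of_lt_one hlt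
    have hpos : (0 : ENNReal) < ENNReal.ofReal (1 / 2) := by simp
    obtain ⟨n, hn, hn'⟩ := (hhalf.and (h0.eventually_lt_const hpos)).exists
    exact absurd hn (not_le.2 hn')
  have hae : ∀ᵐ ω ∂P, ∀ i, x i ω ∈ s := by
    refine ae_all_iff.2 fun i => ?_
    have h := (hident i).measure_mem_eq hsm
    rw [hone] at h
    exact (prob_compl_eq_zero_iff (hx i hsm)).2 h
  refine ⟨p * |C|, by positivity, ?_⟩
  filter_upwards [hae] with ω hω i
  refine (norm_le_l1Norm _).trans ?_
  calc l1Norm (x i ω) ≤ ∑ _j : Fin p, |C| :=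
        Finset.sum_le_sum fun j _ => (hω i j).trans (le_abs_self _)
    _ = p * |C| := by simp

/-- If the rows lay in a hyperplane, the design matrix would not be injective, so that its smallest
singular value would vanish. -/
lemma eq_zero_of_ae_inner_eq_zero [IsProbabilityMeasure P]
    (hident : ∀ i, IdentDistrib (x i) (x 0) P P) (hD : DesignCondition P x)
    (t : EuclideanSpace ℝ (Fin p)) (ht : ∀ᵐ ω ∂P, inner ℝ (x 0 ω) t = 0) : t = 0 := by
  by_contra hne
  obtain ⟨l, hl, u, -, hlim⟩ := hD.singularValues
  have hall : ∀ᵐ ω ∂P, ∀ i, inner ℝ (x i ω) t = 0 := by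
    refine ae_all_iff.2 fun i => ?_
    have hm : MeasurableSet {v : EuclideanSpace ℝ (Fin p) | inner ℝ v t = 0} :=
      measurableSet_eq_fun (by fun_prop) measurable_const
    exact (hident i).symm.ae_snd hm ht
  have hone : ∀ n : ℕ, P {ω | ¬
      (l ≤ minSingularValue ((Real.sqrt n)⁻¹ • designMatrix n fun i => x i ω) ∧
        maxSingularValue ((Real.sqrt n)⁻¹ • designMatrix n fun i => x i ω) ≤ u)} = 1 := by
    intro n
    rw [← measure_univ (μ := P)]
    refine measure_congr ?_
    filter_upwards [hall] with ω hω
    refine propext ⟨fun _ => trivial, fun _ => ?_⟩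
    rintro ⟨hle, -⟩
    set T := Matrix.toEuclideanLin ((Real.sqrt n)⁻¹ • designMatrix n fun i => x i ω) with hT
    have hTt : T t = 0 := by
      ext i
      have h := hω i
      simp only [PiLp.inner_apply] at h
      simp only [hT, Matrix.toLpLin_apply, Matrix.smul_mulVec, WithLp.toLp_smul, PiLp.smul_apply,
        PiLp.zero_apply, smul_eq_mul]
      refine mul_eq_zero_of_right _ ?_
      rw [← h]
      simp [Matrix.mulVec, dotProduct, designMatrix, mul_comm]
    have hinj : ¬ Function.Injective T := fun h => hne (h (by rw [hTt, map_zero]))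
    rw [T.injective_iff_forall_lt_finrank_singularValues_pos] at hinj
    push Not at hinj
    obtain ⟨i, hi, hi0⟩ := hinj
    rw [finrank_euclideanSpace_fin] at hi
    have hanti := T.singularValues_antitone (show i ≤ p - 1 by omega)
    have : l ≤ T.singularValues (p - 1) := hle
    linarith
  simp only [hone] at hlim
  exact one_ne_zero (tendsto_nhds_unique tendsto_const_nhds hlim)

end Design

namespace GLM

variable (M : GLM) {p : ℕ}

/-- The properties of a covariate vector used in the linearisation of the score: it is bounded by
`B`, and for parameters within `ℓ¹` distance `δ` of `β₀` its linear predictor is a natural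
parameter whose weight differs from that at `β₀` at most by the difference of the predictors. -/
structure IsRegularCovariate (β₀ : EuclideanSpace ℝ (Fin p)) (δ B : ℝ)
    (x : EuclideanSpace ℝ (Fin p)) : Prop where
  norm_le : ‖x‖ ≤ B
  mem_param : ∀ β, l1Norm (β - β₀) < δ → inner ℝ x β ∈ M.Θ
  weight_sub_le : ∀ β, l1Norm (β - β₀) < δ →
    |M.weight (inner ℝ x β) - M.weight (inner ℝ x β₀)| ≤ |inner ℝ x (β - β₀)|

variable {M} {β₀ : EuclideanSpace ℝ (Fin p)} {δ : ℝ}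

lemma isOpen_l1Ball : IsOpen {β : EuclideanSpace ℝ (Fin p) | l1Norm (β - β₀) < δ} :=
  isOpen_lt (continuous_l1Norm.comp (continuous_id.sub continuous_const)) continuous_const

/-- A linear predictor attains values on both sides of its value at a point of an open set, at
points of a dense set; as the parameter space is an interval, membership extends from the
dense set to the open set. -/
lemma inner_mem_param_of_dense {D : Set (EuclideanSpace ℝ (Fin p))} (hD : Dense D)
    {x : EuclideanSpace ℝ (Fin p)} (h0 : inner ℝ x β₀ ∈ M.Θ)
    (h : ∀ β ∈ D, l1Norm (β - β₀) < δ → inner ℝ x β ∈ M.Θ)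
    {β : EuclideanSpace ℝ (Fin p)} (hβ : l1Norm (β - β₀) < δ) : inner ℝ x β ∈ M.Θ := by
  rcases eq_or_ne x 0 with rfl | hx
  · simpa using h0
  have key : ∀ r : ℝ, r ≠ 0 → ∃ β' ∈ D, l1Norm (β' - β₀) < δ ∧
      0 < r * (inner ℝ x β' - inner ℝ x β) := by
    intro r hr
    have hopen : IsOpen {β' : EuclideanSpace ℝ (Fin p) | l1Norm (β' - β₀) < δ ∧
        0 < r * (inner ℝ x β' - inner ℝ x β)} :=
      isOpen_l1Ball.inter (isOpen_lt continuous_const (by fun_prop :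
        Continuous fun β' : EuclideanSpace ℝ (Fin p) => r * (inner ℝ x β' - inner ℝ x β)))
    have hc : Continuous fun t : ℝ => β + t • (r • x) := by fun_prop
    have hnear : ∀ᶠ t in 𝓝[>] (0 : ℝ), l1Norm (β + t • (r • x) - β₀) < δ := by
      refine mem_nhdsWithin_of_mem_nhds ((isOpen_l1Ball.preimage hc).mem_nhds ?_)
      simpa using hβ
    obtain ⟨t, ht1, ht2⟩ := (hnear.and self_mem_nhdsWithin).exists
    have hpos : 0 < r * (inner ℝ x (β + t • (r • x)) - inner ℝ x β) := by
      have hxx : 0 < inner ℝ x x := real_inner_self_pos.2 hx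
      have hr2 : 0 < r ^ 2 := by positivity
      have ht : 0 < t := ht2
      rw [inner_add_right, inner_smul_right, inner_smul_right]
      have : r * (inner ℝ x β + t * (r * inner ℝ x x) - inner ℝ x β) =
          t * r ^ 2 * inner ℝ x x := by ring
      rw [this]
      positivity
    obtain ⟨β', hβ', hmem⟩ := hD.exists_mem_open hopen ⟨_, ht1, hpos⟩
    exact ⟨β', hβ', hmem⟩
  obtain ⟨β₁, hD₁, hδ₁, h₁⟩ := key 1 one_ne_zero
  obtain ⟨β₂, hD₂, hδ₂, h₂⟩ := key (-1) (by norm_num)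
  exact M.ordConnected.out (h β₂ hD₂ hδ₂) (h β₁ hD₁ hδ₁) ⟨by linarith, by linarith⟩

lemma weight_sub_le_of_dense {D : Set (EuclideanSpace ℝ (Fin p))} (hD : Dense D)
    {x : EuclideanSpace ℝ (Fin p)}
    (hΘ : ∀ β, l1Norm (β - β₀) < δ → inner ℝ x β ∈ M.Θ)
    (h : ∀ β ∈ D, l1Norm (β - β₀) < δ →
      |M.weight (inner ℝ x β) - M.weight (inner ℝ x β₀)| ≤ |inner ℝ x (β - β₀)|)
    {β : EuclideanSpace ℝ (Fin p)} (hβ : l1Norm (β - β₀) < δ) :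
    |M.weight (inner ℝ x β) - M.weight (inner ℝ x β₀)| ≤ |inner ℝ x (β - β₀)| := by
  have hcl := hD.open_subset_closure_inter (isOpen_l1Ball (β₀ := β₀) (δ := δ)) hβ
  rw [mem_closure_iff_frequently] at hcl
  have hw : ContinuousAt (fun β => M.weight (inner ℝ x β)) β :=
    ContinuousAt.comp (f := fun β => inner ℝ x β) (M.continuousAt_weight (hΘ β hβ))
      (by fun_prop)
  have hcont : ContinuousAt (fun β => |M.weight (inner ℝ x β) - M.weight (inner ℝ x β₀)| -
      |inner ℝ x (β - β₀)|) β :=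
    (hw.sub continuousAt_const).abs.sub (by fun_prop)
  have := le_of_tendsto_of_frequently hcont.tendsto
    (hcl.mono fun β' h' => sub_nonpos.2 (h β' h'.2 h'.1))
  exact sub_nonpos.1 this

variable {Ω : Type*} [MeasurableSpace Ω] {P : Measure Ω}
  {x : ℕ → Ω → EuclideanSpace ℝ (Fin p)} {y : ℕ → Ω → ℝ} {B : ℝ}

/-- The regularity of one covariate is inherited by all of them. Equality of laws transfers
only almost sure statements about measurable sets, so the transfer is made for a countable dense
set of parameters. -/
lemma IsSample.ae_isRegularCovariate (hs : M.IsSample P β₀ x y)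
    (hB : ∀ᵐ ω ∂P, ∀ i, ‖x i ω‖ ≤ B)
    (hΘ : ∀ᵐ ω ∂P, ∀ β, l1Norm (β - β₀) < δ → inner ℝ (x 0 ω) β ∈ M.Θ)
    (hw : ∀ᵐ ω ∂P, ∀ β, l1Norm (β - β₀) < δ →
      |M.weight (inner ℝ (x 0 ω) β) - M.weight (inner ℝ (x 0 ω) β₀)| ≤
        |inner ℝ (x 0 ω) (β - β₀)|) :
    ∀ᵐ ω ∂P, ∀ i, M.IsRegularCovariate β₀ δ B (x i ω) := by
  obtain ⟨D, hDc, hD⟩ := TopologicalSpace.exists_countable_dense (EuclideanSpace ℝ (Fin p))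
  have hmw := M.measurable_weight
  have hmΘ : ∀ β, MeasurableSet {v : EuclideanSpace ℝ (Fin p) | inner ℝ v β ∈ M.Θ} := fun β =>
    (M.isOpen.preimage (by fun_prop : Continuous fun v : EuclideanSpace ℝ (Fin p) =>
      inner ℝ v β)).measurableSet
  have h1 : ∀ᵐ ω ∂P, ∀ i, ∀ β ∈ D, l1Norm (β - β₀) < δ → inner ℝ (x i ω) β ∈ M.Θ := by
    refine ae_all_iff.2 fun i => (ae_ball_iff hDc).2 fun β _ => ?_
    by_cases hβ : l1Norm (β - β₀) < δ
    · have h := (hs.identDistrib_x i).symm.ae_snd (hmΘ β)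
        (by filter_upwards [hΘ] with ω h using h β hβ)
      filter_upwards [h] with ω h _ using h
    · exact ae_of_all _ fun ω h => absurd h hβ
  have h2 : ∀ᵐ ω ∂P, ∀ i, ∀ β ∈ D, l1Norm (β - β₀) < δ →
      |M.weight (inner ℝ (x i ω) β) - M.weight (inner ℝ (x i ω) β₀)| ≤
        |inner ℝ (x i ω) (β - β₀)| := by
    refine ae_all_iff.2 fun i => (ae_ball_iff hDc).2 fun β _ => ?_
    by_cases hβ : l1Norm (β - β₀) < δ
    · have hm : MeasurableSet {v : EuclideanSpace ℝ (Fin p) |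
          |M.weight (inner ℝ v β) - M.weight (inner ℝ v β₀)| ≤ |inner ℝ v (β - β₀)|} :=
        measurableSet_le
          ((hmw.comp (by fun_prop)).sub (hmw.comp (by fun_prop))).abs
          (by fun_prop : Continuous fun v : EuclideanSpace ℝ (Fin p) =>
            |inner ℝ v (β - β₀)|).measurable
      have h := (hs.identDistrib_x i).symm.ae_snd hm
        (by filter_upwards [hw] with ω h using h β hβ)
      filter_upwards [h] with ω h _ using h
    · exact ae_of_all _ fun ω h => absurd h hβ
  have h3 : ∀ᵐ ω ∂P, ∀ i, inner ℝ (x i ω) β₀ ∈ M.Θ :=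
    ae_all_iff.2 fun i => (hs.identDistrib_x i).symm.ae_snd (hmΘ β₀) hs.mem_param
  filter_upwards [hB, h1, h2, h3] with ω hB h1 h2 h3 i
  have hmem : ∀ β, l1Norm (β - β₀) < δ → inner ℝ (x i ω) β ∈ M.Θ :=
    fun β hβ => inner_mem_param_of_dense hD (h3 i) (h1 i) hβ
  exact ⟨hB i, hmem, fun β hβ => weight_sub_le_of_dense hD hmem (h2 i) hβ⟩

end GLM

/-! ### Linearisation of the score -/

namespace GLM

variable {M : GLM} {p : ℕ} {β₀ β : EuclideanSpace ℝ (Fin p)} {δ B : ℝ}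

/-- The mean value inequality for the mean function along the segment from `β₀` to `β`. Both the
weight on the segment and the weight at `β` are within `|xᵀ (β - β₀)|` of the weight at `β₀`,
whence the constant `2`. -/
lemma IsRegularCovariate.abs_invLink_sub_le {x : EuclideanSpace ℝ (Fin p)}
    (hx : M.IsRegularCovariate β₀ δ B x) (hβ : l1Norm (β - β₀) < δ) :
    |M.invLink (inner ℝ x β) - M.invLink (inner ℝ x β₀) -
      M.weight (inner ℝ x β) * inner ℝ x (β - β₀)| ≤ 2 * inner ℝ x (β - β₀) ^ 2 := by
  set d := inner ℝ x (β - β₀) with hd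
  have hline : ∀ t : ℝ, inner ℝ x (β₀ + t • (β - β₀)) = inner ℝ x β₀ + t * d := fun t => by
    rw [inner_add_right, inner_smul_right]
  have hmem : ∀ t ∈ Set.Icc (0 : ℝ) 1, l1Norm (β₀ + t • (β - β₀) - β₀) < δ := by
    intro t ht
    have : l1Norm (β₀ + t • (β - β₀) - β₀) = t * l1Norm (β - β₀) := by
      simp only [l1Norm, add_sub_cancel_left, PiLp.smul_apply, smul_eq_mul, abs_mul,
        abs_of_nonneg ht.1, Finset.mul_sum]
    rw [this]
    exact (mul_le_of_le_one_left (l1Norm_nonneg _) ht.2).trans_lt hβ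
  have hderiv : ∀ t ∈ Set.Icc (0 : ℝ) 1, HasDerivWithinAt
      (fun t => M.invLink (inner ℝ x β₀ + t * d) - t * (M.weight (inner ℝ x β) * d))
      (M.weight (inner ℝ x β₀ + t * d) * d - M.weight (inner ℝ x β) * d) (Set.Icc 0 1) t := by
    intro t ht
    have h1 := M.hasDerivAt_invLink (hx.mem_param _ (hmem t ht))
    rw [hline] at h1
    have h2 : HasDerivAt (fun t => inner ℝ x β₀ + t * d) d t := by
      simpa using ((hasDerivAt_id t).mul_const d).const_add (inner ℝ x β₀)
    have h3 := (hasDerivAt_id t).mul_const (M.weight (inner ℝ x β) * d)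
    rw [one_mul] at h3
    exact ((HasDerivAt.comp t h1 h2).sub h3).hasDerivWithinAt
  have hbound : ∀ t ∈ Set.Ico (0 : ℝ) 1,
      ‖M.weight (inner ℝ x β₀ + t * d) * d - M.weight (inner ℝ x β) * d‖ ≤ 2 * d ^ 2 := by
    intro t ht
    have h1 := hx.weight_sub_le _ (hmem t ⟨ht.1, ht.2.le⟩)
    have h2 := hx.weight_sub_le _ hβ
    rw [hline, add_sub_cancel_left, inner_smul_right, ← hd, abs_mul, abs_of_nonneg ht.1] at h1
    have h1' : |M.weight (inner ℝ x β₀ + t * d) - M.weight (inner ℝ x β₀)| ≤ |d| :=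
      h1.trans (mul_le_of_le_one_left (abs_nonneg _) ht.2.le)
    rw [← sub_mul, Real.norm_eq_abs, abs_mul, ← sq_abs d, sq, ← mul_assoc]
    refine mul_le_mul_of_nonneg_right ?_ (abs_nonneg _)
    have := abs_sub_le (M.weight (inner ℝ x β₀ + t * d)) (M.weight (inner ℝ x β₀))
      (M.weight (inner ℝ x β))
    rw [abs_sub_comm (M.weight (inner ℝ x β₀)) (M.weight (inner ℝ x β))] at this
    linarith
  have hmv := norm_image_sub_le_of_norm_deriv_le_segment_01' hderiv hbound
  have hend : inner ℝ x β₀ + 1 * d = inner ℝ x β := by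
    rw [hd, inner_sub_right]
    ring
  rw [hend, zero_mul, zero_mul, add_zero, one_mul, sub_zero, Real.norm_eq_abs] at hmv
  convert hmv using 2
  ring

lemma abs_inner_sub_le {x : EuclideanSpace ℝ (Fin p)} (hx : ‖x‖ ≤ B)
    (v : EuclideanSpace ℝ (Fin p)) : |inner ℝ x v| ≤ B * ‖v‖ :=
  (abs_real_inner_le_norm x v).trans (mul_le_mul_of_nonneg_right hx (norm_nonneg v))

lemma inv_mul_sum_le {n : ℕ} {f : ℕ → ℝ} {K : ℝ} (hK : 0 ≤ K) (hf : ∀ i, f i ≤ K) :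
    (n : ℝ)⁻¹ * ∑ i ∈ Finset.range n, f i ≤ K := by
  have h1 : ∑ i ∈ Finset.range n, f i ≤ n * K := by
    calc ∑ i ∈ Finset.range n, f i ≤ ∑ _i ∈ Finset.range n, K := Finset.sum_le_sum fun i _ => hf i
      _ = n * K := by simp
  rcases Nat.eq_zero_or_pos n with rfl | hn
  · simpa using hK
  · have : (0 : ℝ) < n := by exact_mod_cast hn
    rw [inv_mul_le_iff₀ this]
    exact h1

variable {n : ℕ} {xs : ℕ → EuclideanSpace ℝ (Fin p)} {ys : ℕ → ℝ}

lemma neg_sensitivity_mulVec (v : EuclideanSpace ℝ (Fin p)) :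
    WithLp.toLp 2 ((-(M.sensitivity n xs β)).mulVec v.ofLp) = (n : ℝ)⁻¹ •
      ∑ i ∈ Finset.range n, (M.weight (inner ℝ (xs i) β) / M.φ * inner ℝ (xs i) v) • xs i := by
  ext j
  simp only [sensitivity, Matrix.mulVec, dotProduct, Matrix.neg_apply, Matrix.of_apply, neg_neg,
    PiLp.smul_apply, smul_eq_mul, WithLp.ofLp_sum, Finset.sum_apply]
  simp only [Finset.mul_sum, Finset.sum_mul]
  rw [Finset.sum_comm]
  refine Finset.sum_congr rfl fun i _ => ?_
  have : inner ℝ (xs i) v = ∑ k, xs i k * v k := by simp [PiLp.inner_apply, mul_comm]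
  simp only [this]
  rw [Finset.mul_sum, Finset.sum_mul, Finset.mul_sum]
  exact Finset.sum_congr rfl fun k _ => by ring

/-- The score is linear near `β₀`, with slope taken at the far end of the segment, up to a
quadratic error. -/
lemma norm_score_linearisation_le (hB : 0 ≤ B) (hx : ∀ i, M.IsRegularCovariate β₀ δ B (xs i))
    (hβ : l1Norm (β - β₀) < δ) :
    ‖WithLp.toLp 2 ((-(M.sensitivity n xs β)).mulVec (β - β₀).ofLp) + M.score n xs ys β -
      M.score n xs ys β₀‖ ≤ 2 * B ^ 3 / M.φ * ‖β - β₀‖ ^ 2 := by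
  have hφ := M.φ_pos
  rw [neg_sensitivity_mulVec, score, score, ← smul_add, ← smul_sub, ← Finset.sum_add_distrib,
    ← Finset.sum_sub_distrib, norm_smul, norm_inv, Real.norm_natCast]
  refine (mul_le_mul_of_nonneg_left (norm_sum_le _ _) (by positivity)).trans
    (inv_mul_sum_le (by positivity) fun i => ?_)
  have h1 := (hx i).abs_invLink_sub_le hβ
  have h2 := abs_inner_sub_le (hx i).norm_le (β - β₀)
  rw [← add_smul, ← sub_smul, norm_smul]
  have he : M.weight (inner ℝ (xs i) β) / M.φ * inner ℝ (xs i) (β - β₀) +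
      (ys i - M.invLink (inner ℝ (xs i) β)) / M.φ - (ys i - M.invLink (inner ℝ (xs i) β₀)) / M.φ =
      -((M.invLink (inner ℝ (xs i) β) - M.invLink (inner ℝ (xs i) β₀) -
        M.weight (inner ℝ (xs i) β) * inner ℝ (xs i) (β - β₀)) / M.φ) := by
    ring
  rw [he, norm_neg, norm_div, Real.norm_eq_abs, Real.norm_eq_abs, abs_of_pos hφ]
  have h3 : inner ℝ (xs i) (β - β₀) ^ 2 ≤ (B * ‖β - β₀‖) ^ 2 := by
    rw [← sq_abs]
    gcongr
  calc _ ≤ 2 * (B * ‖β - β₀‖) ^ 2 / M.φ * B := by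
        gcongr
        · linarith
        · exact (hx i).norm_le
    _ = _ := by ring

lemma abs_sensitivity_sub_le (hB : 0 ≤ B) (hx : ∀ i, M.IsRegularCovariate β₀ δ B (xs i))
    (hβ : l1Norm (β - β₀) < δ) (j k : Fin p) :
    |M.sensitivity n xs β j k - M.sensitivity n xs β₀ j k| ≤ B ^ 3 / M.φ * ‖β - β₀‖ := by
  have hφ := M.φ_pos
  simp only [sensitivity, Matrix.of_apply]
  rw [neg_sub_neg, ← mul_sub, ← Finset.sum_sub_distrib, abs_mul, abs_inv, Nat.abs_cast]
  refine (mul_le_mul_of_nonneg_left (Finset.abs_sum_le_sum_abs _ _) (by positivity)).trans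
    (inv_mul_sum_le (by positivity) fun i => ?_)
  have hent : ∀ j, |xs i j| ≤ B := fun j => (PiLp.norm_apply_le (xs i) j).trans (hx i).norm_le
  have h1 := ((hx i).weight_sub_le β hβ).trans (abs_inner_sub_le (hx i).norm_le (β - β₀))
  rw [abs_sub_comm] at h1
  rw [← sub_mul, ← sub_div, abs_mul, abs_mul, abs_div, abs_of_pos hφ]
  calc _ ≤ B * ‖β - β₀‖ / M.φ * (B * B) := by
        gcongr
        · exact hent j
        · exact hent k
    _ = _ := by ring

variable {Ω : Type*} [MeasurableSpace Ω] {P : Measure Ω}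
  {x : ℕ → Ω → EuclideanSpace ℝ (Fin p)} {y : ℕ → Ω → ℝ}
  {βhat : Ω → EuclideanSpace ℝ (Fin p)}

lemma IsSample.aemeasurable_sensitivity (hs : M.IsSample P β₀ x y) (hβ : AEMeasurable βhat P)
    (n : ℕ) : AEMeasurable
      (fun ω => (fun j k => (-(M.sensitivity n (fun i => x i ω) (βhat ω))) j k :
        Fin p → Fin p → ℝ)) P := by
  have hx := hs.measurable_x
  refine aemeasurable_pi_lambda _ fun j => aemeasurable_pi_lambda _ fun k => ?_
  simp only [sensitivity, Matrix.neg_apply, Matrix.of_apply, neg_neg]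
  refine (Finset.aemeasurable_fun_sum _ fun i _ => ?_).const_mul _
  have hw : AEMeasurable (fun ω => M.weight (inner ℝ (x i ω) (βhat ω))) P :=
    M.measurable_weight.comp_aemeasurable ((hx i).aemeasurable.inner hβ)
  fun_prop

lemma IsSample.aemeasurable_score (hs : M.IsSample P β₀ x y) (hβ : AEMeasurable βhat P)
    (n : ℕ) : AEMeasurable
      (fun ω => M.score n (fun i => x i ω) (fun i => y i ω) (βhat ω)) P := by
  have hx := hs.measurable_x
  have hy := hs.measurable_y
  simp only [score]
  refine AEMeasurable.const_smul (Finset.aemeasurable_fun_sum _ fun i _ => ?_) (n : ℝ)⁻¹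
  have hm : AEMeasurable (fun ω => M.invLink (inner ℝ (x i ω) (βhat ω))) P :=
    M.measurable_invLink.comp_aemeasurable ((hx i).aemeasurable.inner hβ)
  fun_prop

/-- The law of large numbers for the sensitivity at the true parameter. -/
lemma IsSample.tendsto_sensitivity [IsProbabilityMeasure P] {C : ℝ} (hs : M.IsSample P β₀ x y)
    (hB : ∀ᵐ ω ∂P, ‖x 0 ω‖ ≤ B) (hC : ∀ᵐ ω ∂P, |M.weight (inner ℝ (x 0 ω) β₀)| ≤ C) :
    TendstoInMeasure P (fun n ω => (fun j k => (-(M.sensitivity n (fun i => x i ω) β₀)) j k :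
      Fin p → Fin p → ℝ)) atTop fun _ => M.infoMatrix P β₀ (x 0) := by
  refine tendstoInMeasure_of_tendsto_ae
    (fun n => (hs.aemeasurable_sensitivity aemeasurable_const n).aestronglyMeasurable) ?_
  have hlln : ∀ j k, ∀ᵐ ω ∂P, Tendsto (fun n => (-(M.sensitivity n (fun i => x i ω) β₀)) j k)
      atTop (𝓝 (M.infoMatrix P β₀ (x 0) j k)) := by
    intro j k
    have hm : Measurable fun v : EuclideanSpace ℝ (Fin p) =>
        M.weight (inner ℝ v β₀) / M.φ * (v j * v k) := by
      have := M.measurable_weight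
      fun_prop
    have hint : Integrable (fun ω => M.weight (inner ℝ (x 0 ω) β₀) / M.φ *
        (x 0 ω j * x 0 ω k)) P := by
      have := hs.integrable_weight_mul hB hC (EuclideanSpace.single j 1)
        (EuclideanSpace.single k 1)
      simpa only [EuclideanSpace.inner_single_right, one_mul, conj_trivial] using this
    have h := strong_law_ae_real
      (fun i ω => M.weight (inner ℝ (x i ω) β₀) / M.φ * (x i ω j * x i ω k)) hint
      (fun i i' hii' => (hs.indep_x.indepFun hii').comp hm hm)
      (fun i => (hs.identDistrib_x i).comp hm)
    filter_upwards [h] with ω hω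
    simp only [sensitivity, infoMatrix, Matrix.neg_apply, Matrix.of_apply, neg_neg]
    simpa only [div_eq_inv_mul] using hω
  have hall : ∀ᵐ ω ∂P, ∀ j k, Tendsto (fun n => (-(M.sensitivity n (fun i => x i ω) β₀)) j k)
      atTop (𝓝 (M.infoMatrix P β₀ (x 0) j k)) :=
    ae_all_iff.2 fun j => ae_all_iff.2 fun k => hlln j k
  filter_upwards [hall] with ω hω
  exact tendsto_pi_nhds.2 fun j => tendsto_pi_nhds.2 fun k => hω j k

end GLM

/-- Multiplied by any power of `n` below `1/2`, here `0` and `1/4`, the rate of estimation of the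
lasso in fixed dimension tends to zero. -/
lemma tendsto_tuning (s p : ℕ) :
    Tendsto (fun n => (s : ℝ) * tuning p n) atTop (𝓝 0) ∧
    Tendsto (fun n : ℕ => Real.sqrt (Real.sqrt n) * (s * tuning p n)) atTop (𝓝 0) := by
  have hsq : Tendsto (fun n : ℕ => Real.sqrt n) atTop atTop :=
    Real.tendsto_sqrt_atTop.comp tendsto_natCast_atTop_atTop
  have h1 : Tendsto (fun n : ℕ => (s * Real.sqrt (Real.log p)) * (Real.sqrt n)⁻¹) atTop (𝓝 0) := by
    simpa using (tendsto_inv_atTop_zero.comp hsq).const_mul (s * Real.sqrt (Real.log p))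
  have h2 : Tendsto (fun n : ℕ => (s * Real.sqrt (Real.log p)) * (Real.sqrt (Real.sqrt n))⁻¹)
      atTop (𝓝 0) := by
    simpa using (tendsto_inv_atTop_zero.comp (Real.tendsto_sqrt_atTop.comp hsq)).const_mul
      (s * Real.sqrt (Real.log p))
  have ht : ∀ n, tuning p n = Real.sqrt (Real.log p) * (Real.sqrt n)⁻¹ := fun n => by
    rw [tuning, Real.sqrt_div (Real.log_natCast_nonneg p), div_eq_mul_inv]
  refine ⟨h1.congr fun n => by rw [ht, mul_assoc], h2.congr fun n => ?_⟩
  have : Real.sqrt (Real.sqrt n) * (Real.sqrt n)⁻¹ = (Real.sqrt (Real.sqrt n))⁻¹ := by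
    rw [← div_eq_mul_inv, Real.sqrt_div_self', one_div]
  rw [ht, ← this]
  ring

/-! ### Asymptotic normality of the bias-corrected estimator -/

theorem theorem1 {Ω : Type*} [MeasurableSpace Ω] (P : Measure Ω) [IsProbabilityMeasure P]
    (M : GLM) {p : ℕ} (hp : 0 < p) (β₀ : EuclideanSpace ℝ (Fin p))
    (x : ℕ → Ω → EuclideanSpace ℝ (Fin p)) (y : ℕ → Ω → ℝ)
    (hsample : M.IsSample P β₀ x y)
    (βhat : ℕ → Ω → EuclideanSpace ℝ (Fin p))
    (hmeas : ∀ n, AEMeasurable (βhat n) P)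
    (hlasso : ∀ n, p < n → ∀ᵐ ω ∂P,
      M.IsLasso n (fun i => x i ω) (fun i => y i ω) (tuning p n) (βhat n ω))
    (hC1 : M.ScoreLinkCondition P β₀ (x 0) (y 0))
    (hC2 : DesignCondition P x)
    (hC3 : RateCondition P β₀ x βhat) :
    (M.infoMatrix P β₀ (x 0)).PosDef ∧
    M.infoMatrix P β₀ (x 0) = M.fisherInformation P β₀ (x 0) (y 0) ∧
    TendstoInMeasure P
      (fun n ω => M.biasCorrected n (fun i => x i ω) (fun i => y i ω) (βhat n ω))
      atTop (fun _ => β₀) ∧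
    TendstoInDistribution
      (fun (n : ℕ) ω => Real.sqrt n •
        (M.biasCorrected n (fun i => x i ω) (fun i => y i ω) (βhat n ω) - β₀))
      atTop id (fun _ => P)
      (multivariateGaussian 0 (M.infoMatrix P β₀ (x 0))⁻¹) := by
  obtain ⟨B, hB0, hB⟩ :=
    exists_ae_norm_le hsample.measurable_x hsample.indep_x hsample.identDistrib_x hC2.entries
  obtain ⟨δ, hδ, hΘ, -, hwC, hwL⟩ := hC1.nhds
  obtain ⟨C, hC⟩ := hwC β₀ (by simpa [l1Norm] using hδ)
  have hB' : ∀ᵐ ω ∂P, ‖x 0 ω‖ ≤ B := hB.mono fun ω h => h 0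
  have hreg := hsample.ae_isRegularCovariate hB hΘ hwL
  have hpos : (M.infoMatrix P β₀ (x 0)).PosDef := hsample.posDef_infoMatrix hB' hC
    (eq_zero_of_ae_inner_eq_zero hsample.identDistrib_x hC2)
  have hφ := M.φ_pos
  -- the estimation error, without and with the factor `n ^ (1/4)`, vanishes in probability
  obtain ⟨ht0, ht1⟩ := tendsto_tuning (numNonzero β₀) p
  have hD0 : TendstoInMeasure P (fun n ω => l1Norm (βhat n ω - β₀)) atTop fun _ => 0 := by
    simpa using hC3.estimation.tendstoInMeasure_mul (r := fun _ => 1) (by simp) (by simpa using ht0)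
  have hD1 := hC3.estimation.tendstoInMeasure_mul (r := fun n : ℕ => Real.sqrt (Real.sqrt n))
    (fun n => Real.sqrt_nonneg _) ht1
  have hgood : Tendsto (fun n => P {ω | ¬ (l1Norm (βhat n ω - β₀) < δ ∧
      ∀ i, M.IsRegularCovariate β₀ δ B (x i ω))}) atTop (𝓝 0) := by
    refine tendsto_measure_not_and (tendsto_measure_not_lt hD0 hδ) ?_
    rw [show P {ω | ¬ ∀ i, M.IsRegularCovariate β₀ δ B (x i ω)} = 0 from hreg]
    exact tendsto_const_nhds
  have hA : TendstoInMeasure P (fun n ω => (fun j k =>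
      (-(M.sensitivity n (fun i => x i ω) (βhat n ω))) j k : Fin p → Fin p → ℝ)) atTop
      fun _ => M.infoMatrix P β₀ (x 0) := by
    have hdiff : TendstoInMeasure P (fun n ω => (fun j k =>
        M.sensitivity n (fun i => x i ω) β₀ j k -
          M.sensitivity n (fun i => x i ω) (βhat n ω) j k : Fin p → Fin p → ℝ)) atTop
        fun _ => 0 := by
      have hY := tendstoInMeasure_comp_const (f := fun z : ℝ => B ^ 3 / M.φ * z) hD0 (by fun_prop)
      simp only [mul_zero] at hY
      refine tendstoInMeasure_zero_of_le hY ?_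
      refine tendsto_of_tendsto_of_tendsto_of_le_of_le tendsto_const_nhds hgood
        (fun _ => zero_le) fun n => measure_mono fun ω hω hg => hω ?_
      have hl := l1Norm_nonneg (βhat n ω - β₀)
      refine (pi_norm_le_iff_of_nonneg (by positivity)).2 fun j =>
        (pi_norm_le_iff_of_nonneg (by positivity)).2 fun k => ?_
      rw [Real.norm_eq_abs, abs_sub_comm]
      refine (GLM.abs_sensitivity_sub_le hB0 hg.2 hg.1 j k).trans ?_
      gcongr
      exact norm_le_l1Norm _
    have h := tendstoInMeasure_add_zero (hsample.tendsto_sensitivity hB' hC) hdiff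
    refine h.congr_left fun n => ae_of_all _ fun ω => ?_
    ext j k
    simp only [Pi.add_apply, Matrix.neg_apply]
    ring
  have hlin : TendstoInMeasure P (fun (n : ℕ) ω => Real.sqrt n •
      (WithLp.toLp 2 ((-(M.sensitivity n (fun i => x i ω) (βhat n ω))).mulVec
          (βhat n ω - β₀).ofLp) +
        M.score n (fun i => x i ω) (fun i => y i ω) (βhat n ω) -
        M.score n (fun i => x i ω) (fun i => y i ω) β₀)) atTop fun _ => 0 := by
    have hY := tendstoInMeasure_comp_const (f := fun z : ℝ => 2 * B ^ 3 / M.φ * z ^ 2) hD1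
      (by fun_prop)
    simp only [ne_eq, OfNat.ofNat_ne_zero, not_false_eq_true, zero_pow, mul_zero] at hY
    refine tendstoInMeasure_zero_of_le hY ?_
    refine tendsto_of_tendsto_of_tendsto_of_le_of_le tendsto_const_nhds hgood
      (fun _ => zero_le) fun n => measure_mono fun ω hω hg => hω ?_
    rw [norm_smul, Real.norm_of_nonneg (Real.sqrt_nonneg _), mul_pow,
      Real.sq_sqrt (Real.sqrt_nonneg _)]
    calc _ ≤ Real.sqrt n * (2 * B ^ 3 / M.φ * ‖βhat n ω - β₀‖ ^ 2) := by
          gcongr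
          exact GLM.norm_score_linearisation_le hB0 hg.2 hg.1
      _ ≤ Real.sqrt n * (2 * B ^ 3 / M.φ * l1Norm (βhat n ω - β₀) ^ 2) := by
          gcongr
          exact norm_le_l1Norm _
      _ = _ := by ring
  have hmain : TendstoInDistribution
      (fun (n : ℕ) ω => Real.sqrt n •
        (M.biasCorrected n (fun i => x i ω) (fun i => y i ω) (βhat n ω) - β₀))
      atTop id (fun _ => P) (multivariateGaussian 0 (M.infoMatrix P β₀ (x 0))⁻¹) :=
    tendstoInDistribution_newtonStep hpos hmeas
      (fun n => hsample.aemeasurable_sensitivity (hmeas n) n)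
      (fun n => hsample.aemeasurable_score (hmeas n) n)
      (hsample.tendstoInDistribution_score hB' hC hC1.score_eq_zero hpos.posSemidef) hA hlin
  refine ⟨hpos, hsample.infoMatrix_eq_fisherInformation hB' hC, ?_, hmain⟩
  have h := tendstoInMeasure_of_sqrt_smul_tendstoInDistribution hmain
  rw [tendstoInMeasure_iff_norm] at h ⊢
  simpa only [sub_zero] using h
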